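/- Let $H\subset\mathbb{R}^2$ be a nonempty compact convex set and let $\lambda>0$. Let $L$ be the length of the boundary curve of $H$ (if $H$ has empty interior, it is a point or a segment, and the boundary curve runs along it twice). For $p\notin H$ let $\varphi(p)$ be the length of a closed string stretched around $H$ and $p$: if $T_+,T_-\in H$ are tangent points of the two supporting lines of $H$ through $p$ (the nearest ones to $p$, if a supporting line meets $H$ in a segment), then $\varphi(p)=\|p-T_+\|+\|p-T_-\|+\ell(p)$, where $\ell(p)$ is the length of the arc of the boundary curve between $T_-$ and $T_+$ on the side opposite to $p$. Then there is a compact set $K_\lambda\subset\mathbb{R}^2$ (a closed billiard table) that contains $H$ in its interior and has boundary $$\partial K_\lambda=\{p\notin H:\ \varphi(p)=L+2\lambda\},$$ with the following properties. 1. $\|p-q\|\ge\lambda$ for all $p\in\partial K_\lambda$ and $q\in H$. 2. $K_\lambda$ is strictly convex, and $\partial K_\lambda$ is a simple closed curve whose arc-length parameterisation is differentiable everywhere and twice differentiable almost everywhere. 3. Let $\hat\Omega$ be the phase space of the billiard in $K_\lambda$, that is, the set of pairs $(q,v)$ with $q\in K_\lambda$ and $v$ a unit vector which, if $q\in\partial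 K_\lambda$, points strictly inwards; a trajectory moves along straight lines with unit speed and reflects at $\partial K_\lambda$ by $v^+=v^--2\langle v^-,\nu\rangle\nu$, where $\nu$ is the inward unit normal. Then $\hat\Omega=\hat\Omega_1\cup\hat\Omega_2$ with $\hat\Omega_1,\hat\Omega_2$ disjoint and invariant under the billiard flow, such that every trajectory in $\hat\Omega_1$ meets $H$ after every reflection and before the next one, and every trajectory in $\hat\Omega_2$ never meets $H$, neither in the future nor in the past. -/

import Mathlib

open Set Filter Topology MeasureTheory
open scoped RealInnerProductSpace

noncomputable section

/-- The Euclidean plane. -/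
abbrev Plane : Type := EuclideanSpace ℝ (Fin 2)

/-- The cross product (signed area) of two plane vectors; it is nonnegative when `b` points to the
left of `a`. -/
def cross (a b : Plane) : ℝ := a 0 * b 1 - a 1 * b 0

/-! ### The string length potential -/

/-- The length of the boundary curve of a compact convex set `H`. If `H` has no interior it is a
point or a line segment, and the boundary curve runs along it twice. -/
def convexPerimeter (H : Set Plane) : ℝ :=
  open Classical in
  if (interior H).Nonempty then (Measure.hausdorffMeasure 1 (frontier H)).toReal
  else 2 * (Measure.hausdorffMeasure 1 H).toReal

/-- The points at which the ray from `p` with `H` on its left touches `H`. -/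
def leftTangentPoints (H : Set Plane) (p : Plane) : Set Plane :=
  {T | T ∈ H ∧ ∀ q ∈ H, 0 ≤ cross (T - p) (q - p)}

/-- The points at which the ray from `p` with `H` on its right touches `H`. -/
def rightTangentPoints (H : Set Plane) (p : Plane) : Set Plane :=
  {T | T ∈ H ∧ ∀ q ∈ H, cross (T - p) (q - p) ≤ 0}

/-- The arc of the boundary of `H` that faces `p`: the points of `H` that are visible from `p`.
For `p` outside the compact convex set `H` its end points are the two tangent points nearest
to `p`. -/
def facingArc (H : Set Plane) (p : Plane) : Set Plane :=
  {q | q ∈ H ∧ ∀ x ∈ segment ℝ p q, x ∈ H → x = q}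

/-- The string length: the distances from `p` to the two tangent points (where a supporting line
touches `H` in a segment, to the nearest point of it) plus the length of the boundary arc between
these two points on the side opposite to `p`, that is, the whole boundary curve without the arc
facing `p`. -/
def stringPotential (H : Set Plane) (p : Plane) : ℝ :=
  Metric.infDist p (leftTangentPoints H p) + Metric.infDist p (rightTangentPoints H p)
    + (convexPerimeter H - (Measure.hausdorffMeasure 1 (facingArc H p)).toReal)

/-! ### Regularity of the boundary -/

/-- `C` is a simple closed curve whose arc-length parameterisation is differentiable everywhere
and twice differentiable almost everywhere. -/
def IsDiffAndAETwiceDiffClosedCurve (C : Set Plane) : Prop :=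
  ∃ (P : ℝ) (γ : ℝ → Plane), 0 < P ∧ Function.Periodic γ P ∧ InjOn γ (Ico 0 P) ∧ range γ = C ∧
    Differentiable ℝ γ ∧ (∀ t, ‖deriv γ t‖ = 1) ∧
    ∀ᵐ t ∂(volume : Measure ℝ), DifferentiableAt ℝ (deriv γ) t

/-! ### The billiard flow -/

/-- `ν` is the unit normal vector to `∂K` at `q` that points into `K`: to first order at `q`, the
set `K` is the half-plane `{x | 0 ≤ ⟪x - q, ν⟫}`. -/
def IsInwardUnitNormal (K : Set Plane) (q ν : Plane) : Prop :=
  ‖ν‖ = 1 ∧ ∀ ε > (0 : ℝ), ∀ᶠ x in 𝓝 q,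
    (ε * ‖x - q‖ < ⟪x - q, ν⟫ → x ∈ K) ∧ (⟪x - q, ν⟫ < -(ε * ‖x - q‖) → x ∉ K)

/-- The phase space of the billiard in `K`: pairs of a position in `K` and a unit velocity which,
at a boundary point, points strictly inwards. -/
def phaseSpace (K : Set Plane) : Set (Plane × Plane) :=
  {x | ‖x.2‖ = 1 ∧ (x.1 ∈ interior K ∨
    (x.1 ∈ frontier K ∧ ∃ ν, IsInwardUnitNormal K x.1 ν ∧ 0 < ⟪x.2, ν⟫))}

/-- The billiard flow in `K`: `BilliardFlow K x t y` says that the state `x` is carried to the state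
`y` in time `t ≥ 0` after finitely many reflections. A state at a boundary point is the state
immediately after the reflection. -/
inductive BilliardFlow (K : Set Plane) : Plane × Plane → ℝ → Plane × Plane → Prop
  | free (q v : Plane) (t : ℝ) (ht : 0 ≤ t) (hint : ∀ s ∈ Ioc 0 t, q + s • v ∈ interior K) :
      BilliardFlow K (q, v) t (q + t • v, v)
  | reflect (q v ν : Plane) (t : ℝ) (ht : 0 < t) (hint : ∀ s ∈ Ioo 0 t, q + s • v ∈ interior K)
      (hbd : q + t • v ∈ frontier K) (hν : IsInwardUnitNormal K (q + t • v) ν) :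
      BilliardFlow K (q, v) t (q + t • v, v - (2 * ⟪v, ν⟫) • ν)
  | trans (x y z : Plane × Plane) (s t : ℝ) (hxy : BilliardFlow K x s y)
      (hyz : BilliardFlow K y t z) : BilliardFlow K x (s + t) z

/-- A set of states is invariant under the billiard flow, forwards and backwards in time. -/
def IsFlowInvariant (K : Set Plane) (A : Set (Plane × Plane)) : Prop :=
  ∀ x ∈ phaseSpace K, ∀ y ∈ phaseSpace K, ∀ t, BilliardFlow K x t y → (x ∈ A ↔ y ∈ A)

/-- The trajectory of `x` meets `H` after every reflection and before the next one. -/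
def MeetsAfterEveryReflection (K H : Set Plane) (x : Plane × Plane) : Prop :=
  ∀ t y, BilliardFlow K x t y → y.1 ∈ frontier K →
    ∃ s > (0 : ℝ), (∀ r ∈ Ioc 0 s, y.1 + r • y.2 ∈ interior K) ∧ y.1 + s • y.2 ∈ H

/-- The trajectory of `x` never meets `H`, neither in the future nor in the past. -/
def NeverMeets (K H : Set Plane) (x : Plane × Plane) : Prop :=
  ∀ t y, (BilliardFlow K x t y ∨ BilliardFlow K y t x) → y.1 ∉ H

end

/-! Let `h` be the support function of `H`, and let the gap of `p` at the angle `θ` be `⟪p, dir θ⟫ -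
h(θ)`. The string around `H` and `p` bounds the convex hull of `H ∪ {p}`, whose support function is
the larger of `h` and `⟪p, dir θ⟫`. In the spirit of Cauchy's perimeter formula, the string
therefore exceeds the perimeter by `excess H p`, the integral over all directions of the positive
part of the gap (`stringPotential_eq`). The angles with positive gap form one interval `(m - β, m +
β)`, `β ≤ π / 2` (`IsWedge`), whose end points are the normals of the two supporting lines through
`p`. Only the length of the arc facing `p` has to be computed (`hlen_normalArc`); the perimeter
cancels and is never evaluated.

The table is the sublevel set `excess ≤ 2 * lam`. As an integral of positive parts of affine
functions, `excess` is convex and 2-Lipschitz, and it vanishes on `H`. This gives compactness and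
the distance bound; strict convexity needs a closer look at the angle `m + β`.

Differentiating under the integral gives the gradient `ort (m - β) - ort (m + β) = 2 sin β • dir m`.
It does not vanish outside of `H`, and on the boundary of the table it is Lipschitz, because tangent
directions from points at distance at least `lam` from `H` vary in a Lipschitz way
(`norm_ort_sub_le`). The unit tangent of the boundary is the normalised gradient turned by a right
angle, so along arc length it is Lipschitz and differentiable almost everywhere.

The gradient points along the bisector `dir m` of the wedge. Reflection at the boundary thus
exchanges the two supporting lines through `p` and preserves the set of lines that meet `H`
(`IsWedge.lineMeets_reflect`). Whether the line carrying a state meets `H` is invariant under the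
flow, and this splits the phase space. -/

namespace StringBilliard

/-! ### Unit vectors and support functions in the plane -/

/-- The unit vector at angle `θ`. -/
noncomputable def dir (θ : ℝ) : Plane := !₂[Real.cos θ, Real.sin θ]

/-- The unit vector at angle `θ + π / 2`. -/
noncomputable def ort (θ : ℝ) : Plane := !₂[-Real.sin θ, Real.cos θ]

@[simp] lemma dir_zero_coord (θ : ℝ) : dir θ 0 = Real.cos θ := by simp [dir]
@[simp] lemma dir_one_coord (θ : ℝ) : dir θ 1 = Real.sin θ := by simp [dir]
@[simp] lemma ort_zero_coord (θ : ℝ) : ort θ 0 = -Real.sin θ := by simp [ort]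
@[simp] lemma ort_one_coord (θ : ℝ) : ort θ 1 = Real.cos θ := by simp [ort]

lemma inner_coord (x y : Plane) : ⟪x, y⟫ = x 0 * y 0 + x 1 * y 1 := by
  simp [PiLp.inner_apply, Fin.sum_univ_two, mul_comm]

lemma norm_sq_coord (x : Plane) : ‖x‖ ^ 2 = x 0 ^ 2 + x 1 ^ 2 := by
  rw [EuclideanSpace.real_norm_sq_eq, Fin.sum_univ_two]

lemma plane_ext {x y : Plane} (h0 : x 0 = y 0) (h1 : x 1 = y 1) : x = y := by
  ext i; fin_cases i <;> assumption

@[simp] lemma norm_dir (θ : ℝ) : ‖dir θ‖ = 1 := by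
  have : ‖dir θ‖ ^ 2 = 1 := by rw [norm_sq_coord]; simp
  nlinarith [norm_nonneg (dir θ)]

@[simp] lemma norm_ort (θ : ℝ) : ‖ort θ‖ = 1 := by
  have : ‖ort θ‖ ^ 2 = 1 := by rw [norm_sq_coord]; simp
  nlinarith [norm_nonneg (ort θ)]

lemma inner_dir_dir (α β : ℝ) : ⟪dir α, dir β⟫ = Real.cos (β - α) := by
  rw [inner_coord, Real.cos_sub]; simp; ring

lemma inner_ort_ort (α β : ℝ) : ⟪ort α, ort β⟫ = Real.cos (β - α) := by
  rw [inner_coord, Real.cos_sub]; simp; ring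

lemma inner_ort_dir (α β : ℝ) : ⟪ort α, dir β⟫ = Real.sin (β - α) := by
  rw [inner_coord, Real.sin_sub]; simp; ring

lemma inner_dir_ort (α β : ℝ) : ⟪dir α, ort β⟫ = -Real.sin (β - α) := by
  rw [inner_coord, Real.sin_sub]; simp; ring

lemma dir_add_pi (θ : ℝ) : dir (θ + Real.pi) = -dir θ := by
  apply plane_ext <;> simp

lemma dir_add_two_pi (θ : ℝ) : dir (θ + 2 * Real.pi) = dir θ := by
  apply plane_ext <;> simp

lemma ort_add_pi (θ : ℝ) : ort (θ + Real.pi) = -ort θ := by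
  apply plane_ext <;> simp

/-- The expansion of a vector in the orthonormal frame at angle `θ`. -/
lemma eq_frame (x : Plane) (θ : ℝ) : x = ⟪x, dir θ⟫ • dir θ + ⟪x, ort θ⟫ • ort θ := by
  have := Real.sin_sq_add_cos_sq θ
  apply plane_ext
  · simp [inner_coord]; linear_combination (-x 0) * this
  · simp [inner_coord]; linear_combination (-x 1) * this

lemma norm_sq_frame (x : Plane) (θ : ℝ) : ‖x‖ ^ 2 = ⟪x, dir θ⟫ ^ 2 + ⟪x, ort θ⟫ ^ 2 := by
  have := Real.sin_sq_add_cos_sq θ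
  rw [norm_sq_coord]; simp [inner_coord]; linear_combination (-x 0 ^ 2 - x 1 ^ 2) * this

lemma continuous_dir : Continuous dir := by
  unfold dir
  refine (PiLp.continuous_toLp 2 _).comp (continuous_pi fun i => ?_)
  fin_cases i <;> simp <;> fun_prop

lemma hasDerivAt_inner_ort (x : Plane) (θ : ℝ) :
    HasDerivAt (fun θ => ⟪x, ort θ⟫) (-⟪x, dir θ⟫) θ := by
  simp only [inner_coord, ort_zero_coord, ort_one_coord, dir_zero_coord, dir_one_coord]
  have h1 := ((Real.hasDerivAt_sin θ).neg.const_mul (x 0))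
  have h2 := ((Real.hasDerivAt_cos θ).const_mul (x 1))
  exact (h1.add h2).congr_deriv (by ring)

lemma integral_inner_dir (x : Plane) (a b : ℝ) :
    ∫ θ in a..b, ⟪x, dir θ⟫ = ⟪x, ort a⟫ - ⟪x, ort b⟫ := by
  have h : ∀ θ ∈ uIcc a b, HasDerivAt (fun θ => -⟪x, ort θ⟫) (⟪x, dir θ⟫) θ := fun θ _ => by
    exact (hasDerivAt_inner_ort x θ).fun_neg.congr_deriv (by ring)
  rw [intervalIntegral.integral_eq_sub_of_hasDerivAt h]
  · ring
  · exact (continuous_const.inner continuous_dir).intervalIntegrable _ _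

/-- Every unit vector is `dir θ` with `θ` in a given window of length `2 * π`. -/
lemma exists_dir_eq {w : Plane} (hw : ‖w‖ = 1) (m : ℝ) :
    ∃ θ, |θ - m| ≤ Real.pi ∧ w = dir θ := by
  have h1 : w 0 ^ 2 + w 1 ^ 2 = 1 := by rw [← norm_sq_coord, hw]; norm_num
  -- Turning by `-m` moves the window around `m` to the range of `Complex.arg`.
  let z : ℂ := ⟨w 0, w 1⟩ * Complex.exp (-m * Complex.I)
  have hz : ‖z‖ = 1 := by
    have h2 : ‖(⟨w 0, w 1⟩ : ℂ)‖ = 1 := by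
      have : ‖(⟨w 0, w 1⟩ : ℂ)‖ ^ 2 = 1 := by
        rw [Complex.sq_norm, Complex.normSq_apply]; linarith [h1]
      nlinarith [norm_nonneg (⟨w 0, w 1⟩ : ℂ)]
    have h3 : ‖Complex.exp (-m * Complex.I)‖ = 1 := by
      have := Complex.norm_exp_ofReal_mul_I (-m); simpa using this
    simp only [z, norm_mul, h2, h3, mul_one]
  have h4 : Complex.exp (Complex.arg z * Complex.I) = z := by
    have := Complex.norm_mul_exp_arg_mul_I z
    rwa [hz, Complex.ofReal_one, one_mul] at this
  have h5 : Complex.exp ((Complex.arg z + m : ℝ) * Complex.I) = ⟨w 0, w 1⟩ := by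
    have : ((Complex.arg z + m : ℝ) : ℂ) * Complex.I
        = Complex.arg z * Complex.I + m * Complex.I := by push_cast; ring
    rw [this, Complex.exp_add, h4]
    simp only [z]
    rw [mul_assoc, ← Complex.exp_add]; simp
  refine ⟨Complex.arg z + m, ?_, ?_⟩
  · simpa using Complex.abs_arg_le_pi z
  · rw [Complex.exp_mul_I, ← Complex.ofReal_cos, ← Complex.ofReal_sin] at h5
    apply plane_ext
    · simpa [-Complex.ofReal_cos, -Complex.ofReal_sin] using (congrArg Complex.re h5).symm
    · simpa [-Complex.ofReal_cos, -Complex.ofReal_sin] using (congrArg Complex.im h5).symm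

/-- The expansion of a unit vector between two others. -/
lemma dir_between (α θ β : ℝ) : Real.sin (β - α) • dir θ
    = Real.sin (β - θ) • dir α + Real.sin (θ - α) • dir β := by
  apply plane_ext
  · simp only [PiLp.add_apply, PiLp.smul_apply, smul_eq_mul, dir_zero_coord, Real.sin_sub]
    ring
  · simp only [PiLp.add_apply, PiLp.smul_apply, smul_eq_mul, dir_one_coord, Real.sin_sub]
    ring

/-- The support function of `H` in the direction `dir θ`. -/
noncomputable def supp (H : Set Plane) (θ : ℝ) : ℝ := sSup ((fun x => ⟪x, dir θ⟫) '' H)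

/-- How far `p` lies beyond the supporting line of `H` with outer normal `dir θ`. -/
noncomputable def gap (H : Set Plane) (p : Plane) (θ : ℝ) : ℝ := ⟪p, dir θ⟫ - supp H θ

/-- The face of `H` with outer normal `dir θ`. -/
def face (H : Set Plane) (θ : ℝ) : Set Plane := {x | x ∈ H ∧ ⟪x, dir θ⟫ = supp H θ}

variable {H : Set Plane}

lemma inner_le_supp (hc : IsCompact H) {x : Plane} (hx : x ∈ H) (θ : ℝ) :
    ⟪x, dir θ⟫ ≤ supp H θ := by
  have h : Continuous fun x : Plane => ⟪x, dir θ⟫ := by fun_prop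
  exact le_csSup (hc.image h).bddAbove (mem_image_of_mem _ hx)

lemma face_nonempty (hc : IsCompact H) (hne : H.Nonempty) (θ : ℝ) : (face H θ).Nonempty := by
  obtain ⟨x, hx, h⟩ := (hc.image (f := fun x => ⟪x, dir θ⟫) (by fun_prop)).sSup_mem (hne.image _)
  exact ⟨x, hx, h⟩

lemma supp_le (hc : IsCompact H) (hne : H.Nonempty) {θ r : ℝ} (h : ∀ x ∈ H, ⟪x, dir θ⟫ ≤ r) :
    supp H θ ≤ r := by
  obtain ⟨x, hx, h1⟩ := face_nonempty hc hne θ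
  rw [← h1]; exact h x hx

lemma continuous_supp (hc : IsCompact H) : Continuous (supp H) := by
  have h : Continuous fun x : ℝ × Plane => ⟪x.2, dir x.1⟫ :=
    continuous_snd.inner (continuous_dir.comp continuous_fst)
  exact IsCompact.continuous_sSup (f := fun (θ : ℝ) (x : Plane) => ⟪x, dir θ⟫) hc h

lemma continuous_gap_right (hc : IsCompact H) (p : Plane) : Continuous (gap H p) := by
  have h : Continuous fun θ : ℝ => ⟪p, dir θ⟫ := continuous_const.inner continuous_dir
  have h2 := h.sub (continuous_supp hc)
  exact h2

lemma supp_add_two_pi (θ : ℝ) : supp H (θ + 2 * Real.pi) = supp H θ := by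
  simp only [supp, dir_add_two_pi]

lemma gap_add_two_pi (p : Plane) (θ : ℝ) : gap H p (θ + 2 * Real.pi) = gap H p θ := by
  simp only [gap, dir_add_two_pi, supp_add_two_pi]

lemma gap_nonpos_of_mem (hc : IsCompact H) {x : Plane} (hx : x ∈ H) (θ : ℝ) : gap H x θ ≤ 0 :=
  sub_nonpos.2 (inner_le_supp hc hx θ)

lemma gap_pos_iff (hc : IsCompact H) (hne : H.Nonempty) {p : Plane} {θ : ℝ} :
    0 < gap H p θ ↔ ∀ x ∈ H, ⟪x, dir θ⟫ < ⟪p, dir θ⟫ := by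
  unfold gap
  rw [sub_pos]
  constructor
  · intro h x hx; exact (inner_le_supp hc hx θ).trans_lt h
  · intro h
    obtain ⟨x, hx, h1⟩ := face_nonempty hc hne θ
    rw [← h1]; exact h x hx

/-- The supporting lines with opposite normals bound a strip around `H`, and the sum is minus the
width of that strip. -/
lemma gap_add_gap_pi (hc : IsCompact H) (hne : H.Nonempty) (p : Plane) (θ : ℝ) :
    gap H p θ + gap H p (θ + Real.pi) ≤ 0 := by
  obtain ⟨x, hx⟩ := hne
  have h1 := inner_le_supp hc hx θ
  have h2 := inner_le_supp hc hx (θ + Real.pi)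
  simp only [gap, dir_add_pi, inner_neg_right] at *
  linarith

/-- The gap is a concave function of the direction. -/
lemma gap_between (hc : IsCompact H) (hne : H.Nonempty) (p : Plane) {α θ β : ℝ} (h1 : α ≤ θ)
    (h2 : θ ≤ β) (h3 : β - α ≤ Real.pi) :
    Real.sin (β - θ) * gap H p α + Real.sin (θ - α) * gap H p β
      ≤ Real.sin (β - α) * gap H p θ := by
  -- At a point `x` of the face the gap at `θ` is `⟪p - x, dir θ⟫`, which `dir_between` expands; at
  -- `α` and `β` the same point only bounds the gap from above.
  obtain ⟨x, hx, hxθ⟩ := face_nonempty hc hne θ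
  have e1 : 0 ≤ Real.sin (β - θ) := Real.sin_nonneg_of_nonneg_of_le_pi (by linarith) (by linarith)
  have e2 : 0 ≤ Real.sin (θ - α) := Real.sin_nonneg_of_nonneg_of_le_pi (by linarith) (by linarith)
  have key : ∀ y : Plane, Real.sin (β - α) * ⟪y, dir θ⟫
      = Real.sin (β - θ) * ⟪y, dir α⟫ + Real.sin (θ - α) * ⟪y, dir β⟫ := fun y => by
    have := congrArg (fun z => ⟪y, z⟫) (dir_between α θ β)
    simpa [inner_add_right, inner_smul_right] using this
  have k1 := key p
  have k2 := key x
  have l1 := mul_le_mul_of_nonneg_left (inner_le_supp hc hx α) e1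
  have l2 := mul_le_mul_of_nonneg_left (inner_le_supp hc hx β) e2
  simp only [gap, ← hxθ]
  linarith

lemma isCompact_face (hc : IsCompact H) (θ : ℝ) : IsCompact (face H θ) :=
  hc.inter_right (isClosed_eq (f := fun x : Plane => ⟪x, dir θ⟫) (by fun_prop) continuous_const)

lemma convex_face (hconv : Convex ℝ H) (θ : ℝ) : Convex ℝ (face H θ) := by
  intro x hx y hy a b ha hb hab
  refine ⟨hconv hx.1 hy.1 ha hb hab, ?_⟩
  rw [inner_add_left, inner_smul_left, inner_smul_left, hx.2, hy.2]
  simp [← add_mul, hab]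

/-- A point outside of `H` is strictly beyond some supporting line. -/
lemma exists_gap_pos (hconv : Convex ℝ H) (hc : IsCompact H) (hne : H.Nonempty) {p : Plane}
    (hp : p ∉ H) : ∃ θ, 0 < gap H p θ := by
  obtain ⟨q, hq, hmin⟩ := exists_norm_eq_iInf_of_complete_convex hne hc.isComplete hconv p
  have h := (norm_eq_iInf_iff_real_inner_le_zero hconv hq).1 hmin
  have hpq : p - q ≠ 0 := sub_ne_zero.2 fun e => hp (e ▸ hq)
  have hn : 0 < ‖p - q‖ := norm_pos_iff.2 hpq
  obtain ⟨θ, -, hθ⟩ := exists_dir_eq (w := ‖p - q‖⁻¹ • (p - q))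
    (by rw [norm_smul, norm_inv, norm_norm, inv_mul_cancel₀ hn.ne']) 0
  refine ⟨θ, (gap_pos_iff hc hne).2 fun x hx => ?_⟩
  rw [← hθ, inner_smul_right, inner_smul_right]
  refine mul_lt_mul_of_pos_left ?_ (inv_pos.2 hn)
  have h1 := h x hx
  have h2 : 0 < ⟪p - q, p - q⟫ := by rw [real_inner_self_eq_norm_sq]; positivity
  rw [real_inner_comm, inner_sub_left] at h1
  rw [inner_sub_left] at h2
  linarith

/-! ### The length of boundary arcs -/

/-- The part of the boundary of `H` that has an outer normal at an angle in `[a, b]`. -/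
def normalArc (H : Set Plane) (a b : ℝ) : Set Plane := {x | ∃ θ ∈ Icc a b, x ∈ face H θ}

/-- The position of the last point of a face. -/
noncomputable def tauMax (H : Set Plane) (θ : ℝ) : ℝ := sSup ((fun x => ⟪x, ort θ⟫) '' face H θ)

/-- The position of the first point of a face. -/
noncomputable def tauMin (H : Set Plane) (θ : ℝ) : ℝ := sInf ((fun x => ⟪x, ort θ⟫) '' face H θ)

lemma continuous_inner_ort (θ : ℝ) : Continuous fun x : Plane => ⟪x, ort θ⟫ := by fun_prop

lemma inner_ort_le_tauMax (hc : IsCompact H) {θ : ℝ} {x : Plane} (hx : x ∈ face H θ) :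
    ⟪x, ort θ⟫ ≤ tauMax H θ :=
  le_csSup ((isCompact_face hc θ).image (continuous_inner_ort θ)).bddAbove (mem_image_of_mem _ hx)

lemma tauMin_le_inner_ort (hc : IsCompact H) {θ : ℝ} {x : Plane} (hx : x ∈ face H θ) :
    tauMin H θ ≤ ⟪x, ort θ⟫ :=
  csInf_le ((isCompact_face hc θ).image (continuous_inner_ort θ)).bddBelow (mem_image_of_mem _ hx)

lemma exists_inner_ort_eq_tauMax (hc : IsCompact H) (hne : H.Nonempty) (θ : ℝ) :
    ∃ x ∈ face H θ, ⟪x, ort θ⟫ = tauMax H θ :=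
  ((isCompact_face hc θ).image (continuous_inner_ort θ)).sSup_mem ((face_nonempty hc hne θ).image _)

lemma exists_inner_ort_eq_tauMin (hc : IsCompact H) (hne : H.Nonempty) (θ : ℝ) :
    ∃ x ∈ face H θ, ⟪x, ort θ⟫ = tauMin H θ :=
  ((isCompact_face hc θ).image (continuous_inner_ort θ)).sInf_mem ((face_nonempty hc hne θ).image _)

lemma isCompact_normalArc (hc : IsCompact H) (a b : ℝ) : IsCompact (normalArc H a b) := by
  have hcl : IsClosed {y : ℝ × Plane | ⟪y.2, dir y.1⟫ = supp H y.1} := by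
    refine isClosed_eq ?_ ((continuous_supp hc).comp continuous_fst)
    exact continuous_snd.inner (continuous_dir.comp continuous_fst)
  have := (((isCompact_Icc (a := a) (b := b)).prod hc).inter_right hcl).image continuous_snd
  convert this using 1
  ext x
  constructor
  · rintro ⟨θ, h1, h2, h3⟩; exact ⟨(θ, x), ⟨⟨h1, h2⟩, h3⟩, rfl⟩
  · rintro ⟨⟨θ, y⟩, ⟨⟨h1, h2⟩, h3⟩, rfl⟩; exact ⟨θ, h1, h2, h3⟩

lemma normalArc_self (θ : ℝ) : normalArc H θ θ = face H θ := by
  ext x; simp [normalArc]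

lemma normalArc_union {a b c : ℝ} (hab : a ≤ b) (hbc : b ≤ c) :
    normalArc H a c = normalArc H a b ∪ normalArc H b c := by
  ext x
  constructor
  · rintro ⟨θ, h1, h2⟩
    rcases le_total θ b with h | h
    · exact Or.inl ⟨θ, ⟨h1.1, h⟩, h2⟩
    · exact Or.inr ⟨θ, ⟨h, h1.2⟩, h2⟩
  · rintro (⟨θ, h1, h2⟩ | ⟨θ, h1, h2⟩)
    · exact ⟨θ, ⟨h1.1, h1.2.trans hbc⟩, h2⟩
    · exact ⟨θ, ⟨hab.trans h1.1, h1.2⟩, h2⟩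

lemma mem_face_iff_gap {x : Plane} {θ : ℝ} : x ∈ face H θ ↔ x ∈ H ∧ gap H x θ = 0 := by
  simp [face, gap, sub_eq_zero]

/-- The gap of a point of `H` is nonpositive, and by `gap_between` it cannot drop below zero between
two zeros less than `π` apart. -/
lemma mem_face_between (hc : IsCompact H) {x : Plane} {α θ β : ℝ} (h1 : α ≤ θ)
    (h2 : θ ≤ β) (h3 : β - α < Real.pi) (hα : x ∈ face H α) (hβ : x ∈ face H β) :
    x ∈ face H θ := by
  rcases eq_or_lt_of_le (h1.trans h2) with h | h
  · obtain rfl : θ = α := by linarith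
    exact hα
  rw [mem_face_iff_gap] at *
  refine ⟨hα.1, (gap_nonpos_of_mem hc hα.1 θ).antisymm ?_⟩
  have := gap_between hc ⟨x, hα.1⟩ x h1 h2 h3.le
  rw [hα.2, hβ.2, mul_zero, mul_zero, add_zero] at this
  exact nonneg_of_mul_nonneg_right this (Real.sin_pos_of_pos_of_lt_pi (by linarith) h3)

lemma normalArc_inter (hc : IsCompact H) {a b c : ℝ} (hab : a ≤ b) (hbc : b ≤ c)
    (h : c - a < Real.pi) : normalArc H a b ∩ normalArc H b c = face H b := by
  ext x
  constructor
  · rintro ⟨⟨θ, h1, h2⟩, ⟨θ', h3, h4⟩⟩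
    exact mem_face_between hc h1.2 h3.1 (by linarith [h1.1, h3.2]) h2 h4
  · intro hx
    exact ⟨⟨b, ⟨hab, le_rfl⟩, hx⟩, ⟨b, ⟨le_rfl, hbc⟩, hx⟩⟩

lemma inner_frame (x : Plane) (θ φ : ℝ) : ⟪x, ort φ⟫
    = ⟪x, dir θ⟫ * Real.sin (θ - φ) + ⟪x, ort θ⟫ * Real.cos (θ - φ) := by
  conv_lhs => rw [eq_frame x θ]
  rw [inner_add_left, inner_smul_left, inner_smul_left, inner_dir_ort, inner_ort_ort,
    ← Real.sin_neg, ← Real.cos_neg (φ - θ)]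
  simp

lemma inner_frame' (x : Plane) (θ φ : ℝ) : ⟪x, dir φ⟫
    = ⟪x, dir θ⟫ * Real.cos (φ - θ) + ⟪x, ort θ⟫ * Real.sin (φ - θ) := by
  conv_lhs => rw [eq_frame x θ]
  rw [inner_add_left, inner_smul_left, inner_smul_left, inner_dir_dir, inner_ort_dir]
  simp

/-- Chords of an arc of normals in `[a, b]` make an angle of at most `b - a` with `ort a`. -/
lemma chord_bound (hc : IsCompact H) {a b θ θ' : ℝ} (h1 : a ≤ θ) (h2 : θ < θ')
    (h3 : θ' ≤ b) (h4 : b - a < Real.pi / 2) {x y : Plane} (hx : x ∈ face H θ)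
    (hy : y ∈ face H θ') : Real.cos (b - a) * ‖y - x‖ ≤ ⟪y - x, ort a⟫ := by
  set w := y - x
  set d := θ' - θ
  set e := θ - a
  have hd : 0 < d := sub_pos.2 h2
  have hpi := Real.pi_pos
  have hcd : 0 < Real.cos d := Real.cos_pos_of_mem_Ioo ⟨by linarith, by simp only [d]; linarith⟩
  have hsd : 0 < Real.sin d := Real.sin_pos_of_pos_of_lt_pi hd (by simp only [d]; linarith)
  have hse : 0 ≤ Real.sin e :=
    Real.sin_nonneg_of_nonneg_of_le_pi (by simp only [e]; linarith) (by simp only [e]; linarith)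
  -- The two support inequalities place the direction of the chord between `ort θ` and `ort θ'`.
  have hz : ⟪w, dir θ⟫ ≤ 0 := by
    have := inner_le_supp hc hy.1 θ
    simp only [w, inner_sub_left, hx.2]; linarith
  have hz' : 0 ≤ ⟪w, dir θ'⟫ := by
    have := inner_le_supp hc hx.1 θ'
    simp only [w, inner_sub_left, hy.2]; linarith
  rw [inner_frame' w θ θ'] at hz'
  have hn := norm_sq_frame w θ
  rw [inner_frame w θ a]
  change 0 ≤ _ * Real.cos d + _ * Real.sin d at hz'
  change _ ≤ _ * Real.sin e + _ * Real.cos e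
  set X := ⟪w, ort θ⟫
  set z := ⟪w, dir θ⟫
  have hzc : z * Real.cos d ≤ 0 := mul_nonpos_of_nonpos_of_nonneg hz hcd.le
  have hX : 0 ≤ X := by
    by_contra h
    have := mul_neg_of_neg_of_pos (not_le.1 h) hsd
    linarith
  have hwX : Real.cos d * ‖w‖ ≤ X := by
    refine le_of_sq_le_sq ?_ hX
    rw [mul_pow, hn]
    have : (z * Real.cos d) ^ 2 ≤ (X * Real.sin d) ^ 2 := by
      rw [← neg_sq]; exact pow_le_pow_left₀ (by linarith) (by linarith) 2
    nlinarith [Real.sin_sq_add_cos_sq d]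
  have hcb : Real.cos (b - a) ≤ Real.cos (d + e) :=
    Real.cos_le_cos_of_nonneg_of_le_pi (by simp only [d, e]; linarith) (by linarith)
      (by simp only [d, e]; linarith)
  have hcb0 : 0 ≤ Real.cos (b - a) := Real.cos_nonneg_of_mem_Icc ⟨by linarith, by linarith⟩
  refine le_of_mul_le_mul_left ?_ hcd
  have k1 : Real.cos d * (Real.cos (b - a) * ‖w‖) ≤ X * Real.cos (d + e) := by
    calc Real.cos d * (Real.cos (b - a) * ‖w‖) = (Real.cos d * ‖w‖) * Real.cos (b - a) := by ring
      _ ≤ X * Real.cos (d + e) := mul_le_mul hwX hcb hcb0 hX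
  have k2 : 0 ≤ (z * Real.cos d + X * Real.sin d) * Real.sin e := mul_nonneg hz' hse
  rw [Real.cos_add] at k1
  linarith

lemma chord_bound_face {a b θ : ℝ} (h1 : a ≤ θ) (h3 : θ ≤ b) (h4 : b - a < Real.pi / 2)
    {x y : Plane} (hx : x ∈ face H θ) (hy : y ∈ face H θ) (hxy : ⟪x, ort θ⟫ ≤ ⟪y, ort θ⟫) :
    Real.cos (b - a) * ‖y - x‖ ≤ ⟪y - x, ort a⟫ := by
  have hz : ⟪y - x, dir θ⟫ = 0 := by rw [inner_sub_left, hx.2, hy.2, sub_self]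
  have hn := norm_sq_frame (y - x) θ
  have hX : 0 ≤ ⟪y - x, ort θ⟫ := by rw [inner_sub_left]; linarith
  rw [inner_frame (y - x) θ a, hz, zero_mul, zero_add]
  have : ‖y - x‖ = ⟪y - x, ort θ⟫ := by
    rw [hz] at hn
    exact (pow_left_inj₀ (norm_nonneg _) hX two_ne_zero).1 (by linarith)
  rw [this, mul_comm]
  refine mul_le_mul_of_nonneg_left ?_ hX
  exact Real.cos_le_cos_of_nonneg_of_le_pi (by linarith) (by linarith [Real.pi_pos]) (by linarith)

lemma cos_norm_sub_le_abs (hc : IsCompact H) {a b : ℝ} (h : b - a < Real.pi / 2) {x y : Plane}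
    (hx : x ∈ normalArc H a b) (hy : y ∈ normalArc H a b) :
    Real.cos (b - a) * ‖y - x‖ ≤ |⟪y, ort a⟫ - ⟪x, ort a⟫| := by
  obtain ⟨θ, h1, hx⟩ := hx
  obtain ⟨θ', h2, hy⟩ := hy
  have sw : |⟪y, ort a⟫ - ⟪x, ort a⟫| = |⟪x, ort a⟫ - ⟪y, ort a⟫| := abs_sub_comm _ _
  rcases lt_trichotomy θ θ' with h3 | h3 | h3
  · rw [← inner_sub_left]
    exact (chord_bound hc h1.1 h3 h2.2 h hx hy).trans (le_abs_self _)
  · subst h3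
    rcases le_total ⟪x, ort θ⟫ ⟪y, ort θ⟫ with h4 | h4
    · rw [← inner_sub_left]
      exact (chord_bound_face h1.1 h1.2 h hx hy h4).trans (le_abs_self _)
    · rw [sw, norm_sub_rev, ← inner_sub_left]
      exact (chord_bound_face h1.1 h1.2 h hy hx h4).trans (le_abs_self _)
  · rw [sw, norm_sub_rev, ← inner_sub_left]
    exact (chord_bound hc h2.1 h3 h1.2 h hy hx).trans (le_abs_self _)

/-- Chords make an acute angle with `ort a`, so this coordinate is monotone along the arc and its
extremes are attained at the two ends. -/
lemma inner_ort_mem_Icc (hc : IsCompact H) {a b : ℝ} (h : b - a < Real.pi / 2)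
    {A B y : Plane} (hA : A ∈ face H a) (hA' : ⟪A, ort a⟫ = tauMin H a) (hB : B ∈ face H b)
    (hB' : ⟪B, ort b⟫ = tauMax H b) (hy : y ∈ normalArc H a b) :
    ⟪y, ort a⟫ ∈ Icc ⟪A, ort a⟫ ⟪B, ort a⟫ := by
  obtain ⟨θ, h1, hy⟩ := hy
  have hab := h1.1.trans h1.2
  have hcos : 0 ≤ Real.cos (b - a) :=
    Real.cos_nonneg_of_mem_Icc ⟨by linarith [Real.pi_pos], by linarith⟩
  constructor
  · rcases eq_or_lt_of_le h1.1 with h2 | h2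
    · subst h2; rw [hA']; exact tauMin_le_inner_ort hc hy
    · have := (mul_nonneg hcos (norm_nonneg _)).trans (chord_bound hc le_rfl h2 h1.2 h hA hy)
      rwa [inner_sub_left, sub_nonneg] at this
  · rw [← sub_nonneg, ← inner_sub_left]
    rcases eq_or_lt_of_le h1.2 with h2 | h2
    · subst h2
      exact (mul_nonneg hcos (norm_nonneg _)).trans
        (chord_bound_face h1.1 le_rfl h hy hB (hB' ▸ inner_ort_le_tauMax hc hy))
    · exact (mul_nonneg hcos (norm_nonneg _)).trans (chord_bound hc h1.1 h2 le_rfl h hy hB)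

/-- The projection of an arc to the direction `ort a` has no gaps. -/
lemma Icc_subset_image_normalArc (hconv : Convex ℝ H) (hc : IsCompact H) {a b : ℝ}
    (hab : a ≤ b) {A B : Plane} (hA : A ∈ face H a) (hB : B ∈ face H b) :
    Icc ⟪A, ort a⟫ ⟪B, ort a⟫ ⊆ (fun x => ⟪x, ort a⟫) '' normalArc H a b := by
  rintro r ⟨hr1, hr2⟩
  have hne : H.Nonempty := ⟨A, hA.1⟩
  have hcl : ∀ S : Set Plane, IsClosed S → IsClosed {θ | θ ∈ Icc a b ∧ ∃ x ∈ face H θ, x ∈ S} := by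
    intro S hS
    have h1 : IsClosed {y : ℝ × Plane | ⟪y.2, dir y.1⟫ = supp H y.1 ∧ y.2 ∈ S} := by
      refine IsClosed.and (isClosed_eq ?_ ((continuous_supp hc).comp continuous_fst))
        (hS.preimage continuous_snd)
      exact continuous_snd.inner (continuous_dir.comp continuous_fst)
    have := (((isCompact_Icc (a := a) (b := b)).prod hc).inter_right h1).image continuous_fst
    convert this.isClosed using 1
    ext θ
    constructor
    · rintro ⟨hθ, x, hx, hxS⟩; exact ⟨(θ, x), ⟨⟨hθ, hx.1⟩, ⟨hx.2, hxS⟩⟩, rfl⟩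
    · rintro ⟨⟨t, x⟩, ⟨⟨h1, h2⟩, h3, h4⟩, rfl⟩; exact ⟨h1, x, ⟨h2, h3⟩, h4⟩
  -- The angles whose face has a coordinate at most `r`, and those whose face has one at least `r`,
  -- form closed sets covering `[a, b]`. They share an angle by connectedness, and the convex face
  -- there attains `r`.
  have hpre : IsPreconnected (Icc a b) := isPreconnected_Icc
  rw [isPreconnected_closed_iff] at hpre
  have hle : IsClosed {x : Plane | ⟪x, ort a⟫ ≤ r} :=
    isClosed_le (continuous_inner_ort a) continuous_const
  have hge : IsClosed {x : Plane | r ≤ ⟪x, ort a⟫} :=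
    isClosed_le continuous_const (continuous_inner_ort a)
  obtain ⟨θ, hθ, ⟨-, x, hx, hxr⟩, ⟨-, y, hy, hyr⟩⟩ := hpre _ _ (hcl _ hle) (hcl _ hge)
    (by
      intro θ hθ
      obtain ⟨x, hx⟩ := face_nonempty hc hne θ
      rcases le_total ⟪x, ort a⟫ r with h | h
      · exact Or.inl ⟨hθ, x, hx, h⟩
      · exact Or.inr ⟨hθ, x, hx, h⟩)
    ⟨a, ⟨le_rfl, hab⟩, ⟨le_rfl, hab⟩, A, hA, hr1⟩
    ⟨b, ⟨hab, le_rfl⟩, ⟨hab, le_rfl⟩, B, hB, hr2⟩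
  have hcn := ((convex_face hconv θ).isPreconnected.image _
    (continuous_inner_ort a).continuousOn).ordConnected
  obtain ⟨z, hz, hzr⟩ := hcn.out (mem_image_of_mem _ hx) (mem_image_of_mem _ hy)
    (⟨hxr, hyr⟩ : r ∈ Icc _ _)
  exact ⟨z, ⟨θ, hθ, hz⟩, hzr⟩

/-- One-dimensional Hausdorff measure in the plane. -/
noncomputable abbrev hlen : Measure Plane := Measure.hausdorffMeasure 1

/-- On the arc the projection to `ort a` is injective, and its inverse is Lipschitz with constant `1
/ cos (b - a)`. -/
lemma hlen_normalArc_le (hc : IsCompact H) {a b : ℝ} (hab : a ≤ b)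
    (h : b - a < Real.pi / 2) {A B : Plane} (hA : A ∈ face H a) (hA' : ⟪A, ort a⟫ = tauMin H a)
    (hB : B ∈ face H b) (hB' : ⟪B, ort b⟫ = tauMax H b) :
    hlen (normalArc H a b)
      ≤ ENNReal.ofReal ((⟪B, ort a⟫ - ⟪A, ort a⟫) / Real.cos (b - a)) := by
  have hcos : 0 < Real.cos (b - a) :=
    Real.cos_pos_of_mem_Ioo ⟨by linarith [Real.pi_pos], h⟩
  let π : Plane → ℝ := fun x => ⟪x, ort a⟫
  let K : NNReal := ⟨(Real.cos (b - a))⁻¹, by positivity⟩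
  have hb : ∀ x ∈ normalArc H a b, ∀ y ∈ normalArc H a b, dist x y ≤ K * dist (π x) (π y) := by
    intro x hx y hy
    have := cos_norm_sub_le_abs hc h hy hx
    rw [dist_eq_norm, Real.dist_eq]
    change _ ≤ (Real.cos (b - a))⁻¹ * _
    rw [inv_mul_eq_div, le_div_iff₀ hcos, mul_comm]
    exact this
  have hinj : InjOn π (normalArc H a b) := by
    intro x hx y hy hxy
    have := hb x hx y hy
    rw [hxy, dist_self, mul_zero] at this
    exact dist_le_zero.1 this
  have hL : LipschitzOnWith K (Function.invFunOn π (normalArc H a b))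
      (π '' normalArc H a b) := by
    apply LipschitzOnWith.of_dist_le_mul
    rintro _ ⟨x, hx, rfl⟩ _ ⟨y, hy, rfl⟩
    rw [hinj.leftInvOn_invFunOn hx, hinj.leftInvOn_invFunOn hy]
    exact hb x hx y hy
  have h1 := hL.hausdorffMeasure_image_le (d := 1) zero_le_one
  rw [hinj.leftInvOn_invFunOn.image_image, hausdorffMeasure_real, ENNReal.rpow_one] at h1
  refine h1.trans ?_
  have h2 : volume (π '' normalArc H a b) ≤ ENNReal.ofReal (⟪B, ort a⟫ - ⟪A, ort a⟫) := by
    rw [← Real.volume_Icc]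
    refine measure_mono ?_
    rintro _ ⟨y, hy, rfl⟩
    exact inner_ort_mem_Icc hc h hA hA' hB hB' hy
  calc (K : ENNReal) * volume (π '' normalArc H a b)
      ≤ K * ENNReal.ofReal (⟪B, ort a⟫ - ⟪A, ort a⟫) := by gcongr
    _ = ENNReal.ofReal ((⟪B, ort a⟫ - ⟪A, ort a⟫) / Real.cos (b - a)) := by
      rw [div_eq_inv_mul, ENNReal.ofReal_mul (by positivity)]
      congr 1
      exact (ENNReal.ofReal_eq_coe_nnreal _).symm

/-- The projection is 1-Lipschitz and its image covers the whole interval. -/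
lemma le_hlen_normalArc (hconv : Convex ℝ H) (hc : IsCompact H) {a b : ℝ}
    (hab : a ≤ b) {A B : Plane} (hA : A ∈ face H a) (hB : B ∈ face H b) :
    ENNReal.ofReal (⟪B, ort a⟫ - ⟪A, ort a⟫) ≤ hlen (normalArc H a b) := by
  have hL : LipschitzWith 1 fun x : Plane => ⟪x, ort a⟫ := by
    apply LipschitzWith.of_dist_le_mul
    intro x y
    rw [Real.dist_eq, ← inner_sub_left, dist_eq_norm, NNReal.coe_one, one_mul]
    simpa using abs_real_inner_le_norm (x - y) (ort a)
  have h1 := hL.hausdorffMeasure_image_le (d := 1) zero_le_one (normalArc H a b)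
  rw [hausdorffMeasure_real, ENNReal.rpow_one, ENNReal.coe_one, one_mul] at h1
  refine le_trans ?_ h1
  rw [← Real.volume_Icc]
  exact measure_mono (Icc_subset_image_normalArc hconv hc hab hA hB)

lemma hlen_normalArc_lt_top (hc : IsCompact H) (hne : H.Nonempty) {a b : ℝ} (hab : a ≤ b)
    (h : b - a ≤ Real.pi) : hlen (normalArc H a b) < ⊤ := by
  have small : ∀ a b : ℝ, a ≤ b → b - a < Real.pi / 2 → hlen (normalArc H a b) < ⊤ := by
    intro a b hab h
    obtain ⟨A, hA, hA'⟩ := exists_inner_ort_eq_tauMin hc hne a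
    obtain ⟨B, hB, hB'⟩ := exists_inner_ort_eq_tauMax hc hne b
    exact (hlen_normalArc_le hc hab h hA hA' hB hB').trans_lt ENNReal.ofReal_lt_top
  have hpi := Real.pi_pos
  -- Each third spans at most `π / 3`, below the bound `π / 2` of the projection estimate.
  rw [normalArc_union (b := a + (b - a) / 3) (by linarith) (by linarith),
    normalArc_union (a := a + (b - a) / 3) (b := a + 2 * (b - a) / 3) (by linarith) (by linarith)]
  refine measure_union_lt_top (small _ _ (by linarith) (by linarith))
    (measure_union_lt_top (small _ _ (by linarith) (by linarith))
      (small _ _ (by linarith) (by linarith)))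

/-- The length that an arc should have in terms of the support function. -/
noncomputable def arcFormula (H : Set Plane) (a b : ℝ) : ℝ :=
  tauMax H b - tauMin H a + ∫ θ in a..b, supp H θ

lemma norm_dir_sub_dir_le (α β : ℝ) : ‖dir α - dir β‖ ≤ |α - β| := by
  refine le_of_sq_le_sq ?_ (abs_nonneg _)
  rw [@norm_sub_sq_real, norm_dir, norm_dir, inner_dir_dir, sq_abs]
  have := Real.one_sub_sq_div_two_le_cos (x := β - α)
  nlinarith

/-- The difference is the integral of `supp H θ - ⟪B, dir θ⟫`. Since `B` is extreme at the angle
`b`, the integrand at `θ` is at most `D * (b - a)`. -/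
lemma arcFormula_sub_mem (hc : IsCompact H) {a b D : ℝ} (hab : a ≤ b)
    (hD : ∀ x ∈ H, ∀ y ∈ H, ‖x - y‖ ≤ D) {A B : Plane} (hA : ⟪A, ort a⟫ = tauMin H a)
    (hB : B ∈ face H b) (hB' : ⟪B, ort b⟫ = tauMax H b) :
    arcFormula H a b - (⟪B, ort a⟫ - ⟪A, ort a⟫) ∈ Icc 0 (D * (b - a) ^ 2) := by
  have hI1 : IntervalIntegrable (supp H) volume a b := (continuous_supp hc).intervalIntegrable _ _
  have hI2 : IntervalIntegrable (fun θ => ⟪B, dir θ⟫) volume a b :=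
    (continuous_const.inner continuous_dir).intervalIntegrable _ _
  have e : arcFormula H a b - (⟪B, ort a⟫ - ⟪A, ort a⟫)
      = ∫ θ in a..b, (supp H θ - ⟪B, dir θ⟫) := by
    rw [intervalIntegral.integral_sub hI1 hI2, integral_inner_dir, arcFormula, hA, hB']; ring
  have hbd : ∀ θ ∈ Icc a b, supp H θ - ⟪B, dir θ⟫ ≤ D * (b - a) := by
    intro θ hθ
    obtain ⟨y, hy, hy'⟩ := face_nonempty hc ⟨B, hB.1⟩ θ
    have h1 : ⟪y - B, dir b⟫ ≤ 0 := by
      rw [inner_sub_left, hB.2, sub_nonpos]; exact inner_le_supp hc hy b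
    have h2 : ⟪y - B, dir θ - dir b⟫ ≤ D * (b - a) := by
      refine (real_inner_le_norm _ _).trans ?_
      have h3 := norm_dir_sub_dir_le θ b
      rw [abs_sub_comm, abs_of_nonneg (by linarith [hθ.2])] at h3
      exact mul_le_mul (hD y hy B hB.1) (h3.trans (by linarith [hθ.1])) (norm_nonneg _)
        ((norm_nonneg _).trans (hD y hy B hB.1))
    rw [inner_sub_right] at h2
    rw [← hy', ← inner_sub_left]
    linarith
  rw [e]
  constructor
  · exact intervalIntegral.integral_nonneg hab fun θ _ => by
      linarith [inner_le_supp hc hB.1 θ]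
  · calc ∫ θ in a..b, (supp H θ - ⟪B, dir θ⟫) ≤ ∫ _ in a..b, D * (b - a) :=
          intervalIntegral.integral_mono_on hab (hI1.sub hI2) (by simp) hbd
      _ = D * (b - a) ^ 2 := by
        rw [intervalIntegral.integral_const, smul_eq_mul]; ring

/-- Length and formula both lie between `W` and `W + D * (b - a) ^ 2`, where `W` is the projected
length of the arc. A quadratic error on short arcs leaves no error after subdivision. -/
lemma abs_hlen_sub_arcFormula_le (hconv : Convex ℝ H) (hc : IsCompact H) (hne : H.Nonempty)
    {a b D : ℝ} (hab : a ≤ b) (h1 : b - a ≤ 1) (hD : ∀ x ∈ H, ∀ y ∈ H, ‖x - y‖ ≤ D) :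
    |hlen.real (normalArc H a b) - arcFormula H a b| ≤ D * (b - a) ^ 2 := by
  obtain ⟨A, hA, hA'⟩ := exists_inner_ort_eq_tauMin hc hne a
  obtain ⟨B, hB, hB'⟩ := exists_inner_ort_eq_tauMax hc hne b
  have hlt : b - a < Real.pi / 2 := by linarith [Real.pi_gt_three]
  have hcos := Real.one_sub_sq_div_two_le_cos (x := b - a)
  have hhalf : 1 / 2 ≤ Real.cos (b - a) := by nlinarith
  have hW := inner_ort_mem_Icc hc hlt hA hA' hB hB' ⟨b, ⟨hab, le_rfl⟩, hB⟩
  set W := ⟪B, ort a⟫ - ⟪A, ort a⟫ with hWdef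
  have hW0 : 0 ≤ W := sub_nonneg.2 hW.1
  have hWD : W ≤ D := by
    rw [hWdef, ← inner_sub_left]
    refine (real_inner_le_norm _ _).trans ?_
    simpa using hD B hB.1 A hA.1
  have u := hlen_normalArc_le hc hab hlt hA hA' hB hB'
  have l := le_hlen_normalArc hconv hc hab hA hB
  have hfin := (hlen_normalArc_lt_top hc hne hab (by linarith)).ne
  have u' : hlen.real (normalArc H a b) ≤ W / Real.cos (b - a) :=
    ENNReal.toReal_le_of_le_ofReal (by positivity) u
  have l' : W ≤ hlen.real (normalArc H a b) := (ENNReal.ofReal_le_iff_le_toReal hfin).1 l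
  have k := arcFormula_sub_mem hc hab hD hA' hB hB'
  rw [← hWdef] at k
  have u2 : W / Real.cos (b - a) ≤ W + D * (b - a) ^ 2 := by
    rw [div_le_iff₀ (by linarith)]
    have e1 : W * (1 - Real.cos (b - a)) ≤ D * ((b - a) ^ 2 / 2) :=
      mul_le_mul hWD (by linarith) (by linarith [Real.cos_le_one (b - a)]) (hW0.trans hWD)
    have e2 : D * (b - a) ^ 2 * (1 / 2) ≤ D * (b - a) ^ 2 * Real.cos (b - a) :=
      mul_le_mul_of_nonneg_left hhalf (mul_nonneg (hW0.trans hWD) (sq_nonneg _))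
    nlinarith
  rw [abs_le]
  constructor <;> linarith [k.1, k.2]

lemma arcFormula_add (hc : IsCompact H) (a b c : ℝ) : arcFormula H a c
    = arcFormula H a b + arcFormula H b c - (tauMax H b - tauMin H b) := by
  have := intervalIntegral.integral_add_adjacent_intervals
    ((continuous_supp hc).intervalIntegrable (μ := volume) a b)
    ((continuous_supp hc).intervalIntegrable b c)
  simp only [arcFormula, ← this]; ring

lemma exists_norm_sub_le (hc : IsCompact H) : ∃ D, ∀ x ∈ H, ∀ y ∈ H, ‖x - y‖ ≤ D := by
  obtain ⟨D, hD⟩ := hc.isBounded.exists_norm_le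
  exact ⟨D + D, fun x hx y hy => (norm_sub_le _ _).trans (add_le_add (hD x hx) (hD y hy))⟩

lemma hlen_face (hconv : Convex ℝ H) (hc : IsCompact H) (hne : H.Nonempty) (θ : ℝ) :
    hlen.real (face H θ) = tauMax H θ - tauMin H θ := by
  obtain ⟨D, hD⟩ := exists_norm_sub_le hc
  have := abs_hlen_sub_arcFormula_le hconv hc hne (le_refl θ) (by simp) hD
  rw [sub_self, zero_pow two_ne_zero, mul_zero, normalArc_self, arcFormula,
    intervalIntegral.integral_same, add_zero] at this
  exact sub_eq_zero.1 (abs_nonpos_iff.1 this)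

/-- The length of the arc of the boundary whose outer normals have an angle in `[a, b]`. -/
theorem hlen_normalArc (hconv : Convex ℝ H) (hc : IsCompact H) (hne : H.Nonempty) {a b : ℝ}
    (hab : a ≤ b) (hpi : b - a < Real.pi) :
    hlen.real (normalArc H a b) = arcFormula H a b := by
  obtain ⟨D, hD⟩ := exists_norm_sub_le hc
  -- The error `f` is additive over adjacent arcs, since both terms count the common face once too
  -- often. Its increments are quadratically small, so its derivative vanishes.
  set f : ℝ → ℝ := fun x => hlen.real (normalArc H a x) - arcFormula H a x
  have hf : ∀ x ∈ Icc a b, ∀ y ∈ Icc a b, x ≤ y →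
      f y - f x = hlen.real (normalArc H x y) - arcFormula H x y := by
    intro x hx y hy hxy
    have h1 := measureReal_union_add_inter (μ := hlen) (s := normalArc H a x)
      (isCompact_normalArc hc x y).measurableSet
      (hlen_normalArc_lt_top hc hne hx.1 (by linarith [hx.2])).ne
      (hlen_normalArc_lt_top hc hne hxy (by linarith [hx.1, hy.2])).ne
    rw [← normalArc_union hx.1 hxy, normalArc_inter hc hx.1 hxy (by linarith [hy.2]),
      hlen_face hconv hc hne] at h1
    simp only [f]
    rw [arcFormula_add hc a x y]
    linarith
  have hq : ∀ x ∈ Icc a b, ∀ y ∈ Icc a b, x ≤ y → y - x ≤ 1 → |f y - f x| ≤ D * (y - x) ^ 2 := by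
    intro x hx y hy hxy h1
    rw [hf x hx y hy hxy]
    exact abs_hlen_sub_arcFormula_le hconv hc hne hxy h1 hD
  have hq' : ∀ x ∈ Icc a b, ∀ y ∈ Icc a b, |y - x| ≤ 1 → |f y - f x| ≤ D * |y - x| ^ 2 := by
    intro x hx y hy h1
    rcases le_total x y with h | h
    · rw [abs_of_nonneg (sub_nonneg.2 h)] at h1 ⊢
      exact hq x hx y hy h h1
    · rw [abs_sub_comm] at h1
      rw [abs_sub_comm, abs_sub_comm y x]
      rw [abs_of_nonneg (sub_nonneg.2 h)] at h1 ⊢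
      exact hq y hy x hx h h1
  have hder : ∀ x ∈ Icc a b, HasDerivWithinAt f 0 (Icc a b) x := by
    intro x hx
    rw [hasDerivWithinAt_iff_isLittleO]
    simp only [smul_zero, sub_zero]
    refine Asymptotics.IsBigO.trans_isLittleO (g := fun y => |y - x| ^ 2) ?_ ?_
    · refine Asymptotics.IsBigO.of_bound D ?_
      have : ∀ᶠ y in 𝓝[Icc a b] x, |y - x| < 1 := by
        refine nhdsWithin_le_nhds ?_
        have := Metric.ball_mem_nhds x one_pos
        filter_upwards [this] with y hy
        rwa [Metric.mem_ball, Real.dist_eq] at hy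
      filter_upwards [this, self_mem_nhdsWithin] with y hy hy'
      have := hq' x hx y hy' hy.le
      simpa using this
    · simp only [sq_abs]
      have := (Asymptotics.isLittleO_pow_sub_sub x one_lt_two).mono
        (nhdsWithin_le_nhds (s := Icc a b))
      simpa using this
  have hcst := constant_of_has_deriv_right_zero (fun x hx => (hder x hx).continuousWithinAt)
    (fun x hx => ((hder x ⟨hx.1, hx.2.le⟩).mono_of_mem_nhdsWithin (Icc_mem_nhdsGE_of_mem hx)))
    b ⟨hab, le_rfl⟩
  have h0 := hf a ⟨le_rfl, hab⟩ a ⟨le_rfl, hab⟩ le_rfl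
  have hfa : f a = 0 := by linarith
  rw [hfa] at hcst
  exact sub_eq_zero.1 hcst

/-! ### The supporting lines through a point outside of `H` -/

/-- The outer normals of the supporting lines of `H` that separate `p` from `H` have angles in
`(m - β, m + β)`. -/
structure IsWedge (H : Set Plane) (p : Plane) (m β : ℝ) : Prop where
  pos : 0 < β
  le : β ≤ Real.pi / 2
  left : gap H p (m - β) = 0
  right : gap H p (m + β) = 0
  gap_pos : ∀ θ, |θ - m| < β → 0 < gap H p θ
  gap_neg : ∀ θ, β < |θ - m| → |θ - m| ≤ Real.pi → gap H p θ < 0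

/-- Starting at an angle with positive gap, the interval ends at the first zero on either side.
Antipodal gaps cannot both be positive, so its length is at most `π`; beyond its ends `gap_between`,
applied with the midpoint, makes the gap negative. -/
theorem exists_isWedge (hconv : Convex ℝ H) (hc : IsCompact H) (hne : H.Nonempty) {p : Plane}
    (hp : p ∉ H) : ∃ m β, IsWedge H p m β := by
  obtain ⟨θ₀, h0⟩ := exists_gap_pos hconv hc hne hp
  have hpi := Real.pi_pos
  have hg := continuous_gap_right hc p
  have hplus : gap H p (θ₀ + Real.pi) < 0 := by linarith [gap_add_gap_pi hc hne p θ₀]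
  have hminus : gap H p (θ₀ - Real.pi) < 0 := by
    have := gap_add_gap_pi hc hne p (θ₀ - Real.pi)
    rw [sub_add_cancel] at this; linarith
  have hcl : IsClosed {θ | gap H p θ ≤ 0} := isClosed_le hg continuous_const
  obtain ⟨b, ⟨hb1, hb2⟩, hb3⟩ := ((isCompact_Icc (a := θ₀) (b := θ₀ + Real.pi)).inter_right
    hcl).exists_isLeast ⟨θ₀ + Real.pi, ⟨by linarith, le_rfl⟩, hplus.le⟩
  obtain ⟨a, ⟨ha1, ha2⟩, ha3⟩ := ((isCompact_Icc (a := θ₀ - Real.pi) (b := θ₀)).inter_right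
    hcl).exists_isGreatest ⟨θ₀ - Real.pi, ⟨le_rfl, by linarith⟩, hminus.le⟩
  have hb0 : θ₀ < b := lt_of_le_of_ne hb1.1 (by rintro rfl; exact absurd hb2 (not_le.2 h0))
  have ha0 : a < θ₀ := lt_of_le_of_ne ha1.2 (by rintro rfl; exact absurd ha2 (not_le.2 h0))
  have hpos : ∀ θ, a < θ → θ < b → 0 < gap H p θ := by
    intro θ h1 h2
    by_contra h
    rcases le_total θ₀ θ with h3 | h3
    · exact absurd (hb3 ⟨⟨h3, by linarith [hb1.2]⟩, not_lt.1 h⟩) (not_le.2 h2)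
    · exact absurd (ha3 ⟨⟨by linarith [ha1.1], h3⟩, not_lt.1 h⟩) (not_le.2 h1)
  have hge : ∀ θ ∈ Icc a b, 0 ≤ gap H p θ := by
    have h1 : closure (Ioo a b) ⊆ {θ | 0 ≤ gap H p θ} :=
      closure_minimal (fun θ hθ => (hpos θ hθ.1 hθ.2).le) (isClosed_le continuous_const hg)
    rwa [closure_Ioo (by linarith)] at h1
  have hgb : gap H p b = 0 := le_antisymm hb2 (hge b ⟨by linarith, le_rfl⟩)
  have hga : gap H p a = 0 := le_antisymm ha2 (hge a ⟨le_rfl, by linarith⟩)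
  have hba : b - a ≤ Real.pi := by
    by_contra h
    have h1 := hpos ((a + (b - Real.pi)) / 2) (by linarith) (by linarith)
    have h2 := hpos ((a + (b - Real.pi)) / 2 + Real.pi) (by linarith) (by linarith)
    linarith [gap_add_gap_pi hc hne p ((a + (b - Real.pi)) / 2)]
  have hm := hpos ((a + b) / 2) (by linarith) (by linarith)
  refine ⟨(a + b) / 2, (b - a) / 2, by linarith, by linarith, ?_, ?_, ?_, ?_⟩
  · convert hga using 2; ring
  · convert hgb using 2; ring
  · intro θ hθ
    rw [abs_lt] at hθ
    exact hpos θ (by linarith) (by linarith)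
  · intro θ h1 h2
    rw [abs_le] at h2
    rcases lt_abs.1 h1 with h3 | h3
    · rcases eq_or_lt_of_le h2.2 with h4 | h4
      · have := gap_add_gap_pi hc hne p ((a + b) / 2)
        rw [← h4, add_sub_cancel] at this
        linarith
      · have := gap_between hc hne p (α := (a + b) / 2) (θ := b) (β := θ) (by linarith)
          (by linarith) h2.2
        rw [hgb, mul_zero] at this
        have s1 : 0 < Real.sin (θ - b) :=
          Real.sin_pos_of_pos_of_lt_pi (by linarith) (by linarith)
        have s2 : 0 < Real.sin (b - (a + b) / 2) :=
          Real.sin_pos_of_pos_of_lt_pi (by linarith) (by linarith)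
        have s3 := mul_pos s1 hm
        by_contra h
        have s4 := mul_nonneg s2.le (not_lt.1 h)
        linarith
    · rcases eq_or_lt_of_le h2.1 with h4 | h4
      · have := gap_add_gap_pi hc hne p θ
        rw [show θ + Real.pi = (a + b) / 2 by linarith] at this
        linarith
      · have := gap_between hc hne p (α := θ) (θ := a) (β := (a + b) / 2) (by linarith)
          (by linarith) (by linarith)
        rw [hga, mul_zero] at this
        have s1 : 0 < Real.sin (a - θ) :=
          Real.sin_pos_of_pos_of_lt_pi (by linarith) (by linarith)
        have s2 : 0 < Real.sin ((a + b) / 2 - a) :=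
          Real.sin_pos_of_pos_of_lt_pi (by linarith) (by linarith)
        have s3 := mul_pos s1 hm
        by_contra h
        have s4 := mul_nonneg s2.le (not_lt.1 h)
        linarith

lemma exists_gap_pos_window (hconv : Convex ℝ H) (hc : IsCompact H) (hne : H.Nonempty) {p : Plane}
    (hp : p ∉ H) (m : ℝ) : ∃ θ, |θ - m| ≤ Real.pi ∧ 0 < gap H p θ := by
  obtain ⟨θ, hθ⟩ := exists_gap_pos hconv hc hne hp
  obtain ⟨φ, hφ, e⟩ := exists_dir_eq (norm_dir θ) m
  refine ⟨φ, hφ, ?_⟩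
  rw [gap_pos_iff hc hne, ← e]
  exact (gap_pos_iff hc hne).1 hθ

namespace IsWedge

variable {p : Plane} {m β : ℝ}

lemma sin_pos (hw : IsWedge H p m β) : 0 < Real.sin β :=
  Real.sin_pos_of_pos_of_lt_pi hw.pos (by linarith [hw.le, Real.pi_pos])

lemma gap_mid (hw : IsWedge H p m β) : 0 < gap H p m :=
  hw.gap_pos m (by simpa using hw.pos)

/-- Both points lie on the supporting line with normal `dir (m - β)`. The sign comes from the
positive gap at `m`, because `⟪ort (m - β), dir m⟫ = sin β`. -/
lemma sub_eq_right (hw : IsWedge H p m β) (hc : IsCompact H) {T : Plane}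
    (hT : T ∈ face H (m - β)) : p - T = ⟪p - T, ort (m - β)⟫ • ort (m - β)
      ∧ 0 < ⟪p - T, ort (m - β)⟫ := by
  have h0 : ⟪p - T, dir (m - β)⟫ = 0 := by
    have := hw.left
    rw [gap] at this
    rw [inner_sub_left, hT.2, this]
  have h1 := eq_frame (p - T) (m - β)
  rw [h0, zero_smul, zero_add] at h1
  refine ⟨h1, ?_⟩
  have h2 := (gap_pos_iff hc ⟨T, hT.1⟩).1 hw.gap_mid T hT.1
  rw [← sub_pos, ← inner_sub_left, h1, inner_smul_left, inner_ort_dir, sub_sub_cancel] at h2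
  exact (mul_pos_iff_of_pos_right hw.sin_pos).1 h2

lemma sub_eq_left (hw : IsWedge H p m β) (hc : IsCompact H) {T : Plane}
    (hT : T ∈ face H (m + β)) : T - p = ⟪T - p, ort (m + β)⟫ • ort (m + β)
      ∧ 0 < ⟪T - p, ort (m + β)⟫ := by
  have h0 : ⟪T - p, dir (m + β)⟫ = 0 := by
    have := hw.right
    rw [gap] at this
    rw [inner_sub_left, hT.2, ← neg_sub, this, neg_zero]
  have h1 := eq_frame (T - p) (m + β)
  rw [h0, zero_smul, zero_add] at h1
  refine ⟨h1, ?_⟩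
  have h2 := (gap_pos_iff hc ⟨T, hT.1⟩).1 hw.gap_mid T hT.1
  rw [← sub_neg, ← inner_sub_left, h1, inner_smul_left, inner_ort_dir, sub_add_cancel_left,
    Real.sin_neg, mul_neg, neg_lt_zero] at h2
  exact (mul_pos_iff_of_pos_right hw.sin_pos).1 h2

end IsWedge

lemma cross_smul_ort (r θ : ℝ) (w : Plane) : cross (r • ort θ) w = -(r * ⟪w, dir θ⟫) := by
  simp [cross, inner_coord]; ring

lemma cross_swap (v w : Plane) : cross v w = -cross w v := by simp [cross]; ring

namespace IsWedge

variable {p : Plane} {m β : ℝ}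

/-- For `T` on the face, the cross product is a positive multiple of `⟪q - p, dir (m - β)⟫`. Testing
an arbitrary tangent point against a point of the face puts it on the supporting line. -/
theorem rightTangentPoints_eq (hw : IsWedge H p m β) (hc : IsCompact H) (hne : H.Nonempty) :
    rightTangentPoints H p = face H (m - β) := by
  have hgap : ∀ q ∈ H, ⟪q - p, dir (m - β)⟫ ≤ 0 := fun q hq => by
    have := inner_le_supp hc hq (m - β)
    have h2 := hw.left
    rw [gap] at h2
    rw [inner_sub_left]; linarith
  have hmem : ∀ T ∈ face H (m - β), ∀ q, cross (T - p) (q - p)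
      = ⟪p - T, ort (m - β)⟫ * ⟪q - p, dir (m - β)⟫ := fun T hT q => by
    obtain ⟨h1, -⟩ := hw.sub_eq_right hc hT
    rw [← neg_sub p T, h1, ← neg_smul, cross_smul_ort, ← h1]; ring
  ext T
  constructor
  · rintro ⟨hT, h⟩
    obtain ⟨T', hT'⟩ := face_nonempty hc hne (m - β)
    obtain ⟨-, hr⟩ := hw.sub_eq_right hc hT'
    have h1 := h T' hT'.1
    rw [cross_swap, hmem T' hT', neg_nonpos] at h1
    have h2 := nonneg_of_mul_nonneg_right h1 hr
    have h3 := hgap T hT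
    refine ⟨hT, ?_⟩
    have h4 := hw.left
    rw [gap] at h4
    rw [inner_sub_left] at h2 h3
    linarith
  · intro hT
    refine ⟨hT.1, fun q hq => ?_⟩
    rw [hmem T hT]
    exact mul_nonpos_of_nonneg_of_nonpos (hw.sub_eq_right hc hT).2.le (hgap q hq)

theorem leftTangentPoints_eq (hw : IsWedge H p m β) (hc : IsCompact H) (hne : H.Nonempty) :
    leftTangentPoints H p = face H (m + β) := by
  have hgap : ∀ q ∈ H, ⟪q - p, dir (m + β)⟫ ≤ 0 := fun q hq => by
    have := inner_le_supp hc hq (m + β)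
    have h2 := hw.right
    rw [gap] at h2
    rw [inner_sub_left]; linarith
  have hmem : ∀ T ∈ face H (m + β), ∀ q, cross (T - p) (q - p)
      = -(⟪T - p, ort (m + β)⟫ * ⟪q - p, dir (m + β)⟫) := fun T hT q => by
    obtain ⟨h1, -⟩ := hw.sub_eq_left hc hT
    rw [h1, cross_smul_ort, ← h1]
  ext T
  constructor
  · rintro ⟨hT, h⟩
    obtain ⟨T', hT'⟩ := face_nonempty hc hne (m + β)
    obtain ⟨-, hr⟩ := hw.sub_eq_left hc hT'
    have h1 := h T' hT'.1
    rw [cross_swap, hmem T' hT', neg_neg] at h1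
    have h2 := nonneg_of_mul_nonneg_right h1 hr
    have h3 := hgap T hT
    refine ⟨hT, ?_⟩
    have h4 := hw.right
    rw [gap] at h4
    rw [inner_sub_left] at h2 h3
    linarith
  · intro hT
    refine ⟨hT.1, fun q hq => ?_⟩
    rw [hmem T hT, neg_nonneg]
    exact mul_nonpos_of_nonneg_of_nonpos (hw.sub_eq_left hc hT).2.le (hgap q hq)

lemma dist_right (hw : IsWedge H p m β) (hc : IsCompact H) {T : Plane}
    (hT : T ∈ face H (m - β)) : dist p T = ⟪p, ort (m - β)⟫ - ⟪T, ort (m - β)⟫ := by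
  obtain ⟨h1, h2⟩ := hw.sub_eq_right hc hT
  rw [dist_eq_norm, h1, norm_smul, norm_ort, mul_one, Real.norm_of_nonneg h2.le, inner_sub_left]

lemma dist_left (hw : IsWedge H p m β) (hc : IsCompact H) {T : Plane}
    (hT : T ∈ face H (m + β)) : dist p T = ⟪T, ort (m + β)⟫ - ⟪p, ort (m + β)⟫ := by
  obtain ⟨h1, h2⟩ := hw.sub_eq_left hc hT
  rw [dist_comm, dist_eq_norm, h1, norm_smul, norm_ort, mul_one, Real.norm_of_nonneg h2.le,
    inner_sub_left]

/-- Since `p` lies ahead of the face in the direction `ort (m - β)`, the last point of the face is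
nearest; on the left side it is the first point. -/
lemma infDist_right (hw : IsWedge H p m β) (hc : IsCompact H) (hne : H.Nonempty) :
    Metric.infDist p (face H (m - β)) = ⟪p, ort (m - β)⟫ - tauMax H (m - β) := by
  obtain ⟨T, hT, hT'⟩ := exists_inner_ort_eq_tauMax hc hne (m - β)
  refine le_antisymm ?_ ?_
  · rw [← hT', ← hw.dist_right hc hT]; exact Metric.infDist_le_dist_of_mem hT
  · refine (Metric.le_infDist ⟨T, hT⟩).2 fun {y} hy => ?_
    rw [hw.dist_right hc hy]
    linarith [inner_ort_le_tauMax hc hy]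

lemma infDist_left (hw : IsWedge H p m β) (hc : IsCompact H) (hne : H.Nonempty) :
    Metric.infDist p (face H (m + β)) = tauMin H (m + β) - ⟪p, ort (m + β)⟫ := by
  obtain ⟨T, hT, hT'⟩ := exists_inner_ort_eq_tauMin hc hne (m + β)
  refine le_antisymm ?_ ?_
  · rw [← hT', ← hw.dist_left hc hT]; exact Metric.infDist_le_dist_of_mem hT
  · refine (Metric.le_infDist ⟨T, hT⟩).2 fun {y} hy => ?_
    rw [hw.dist_left hc hy]
    linarith [tauMin_le_inner_ort hc hy]

/-! ### The arc facing a point -/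

/-- A visible point `q` has an outer normal `dir φ` with `⟪p - q, dir φ⟫ ≥ 0`; otherwise a small
step towards `p` would stay in `H`. The gap of `p` at `φ` is then nonnegative, which puts `φ` in the
closed wedge. -/
lemma facingArc_subset (hw : IsWedge H p m β) (hconv : Convex ℝ H) (hc : IsCompact H) :
    facingArc H p ⊆ normalArc H (m - β) (m + β) := by
  rintro q ⟨hq, hvis⟩
  have hne : H.Nonempty := ⟨q, hq⟩
  have hpH : p ∉ H := fun h => by
    have := gap_nonpos_of_mem hc h m
    linarith [hw.gap_mid]
  have hpi := Real.pi_pos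
  have hF : Continuous fun θ => min (gap H q θ) ⟪p - q, dir θ⟫ :=
    (continuous_gap_right hc q).min (continuous_const.inner continuous_dir)
  obtain ⟨φ, hφ, hmax⟩ := (isCompact_Icc (a := m - Real.pi) (b := m + Real.pi)).exists_isMaxOn
    ⟨m, by linarith, by linarith⟩ hF.continuousOn
  have hM : 0 ≤ min (gap H q φ) ⟪p - q, dir φ⟫ := by
    by_contra hM
    push Not at hM
    set M := min (gap H q φ) ⟪p - q, dir φ⟫
    have hpq : 0 < ‖p - q‖ := norm_pos_iff.2 (sub_ne_zero.2 fun e => hpH (e ▸ hq))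
    -- A step of this size raises each gap by at most `-M`. Directions in which the gap rises have
    -- gap at most `M` at `q`, so none becomes positive.
    set s := min 1 (-M / ‖p - q‖)
    have hs : 0 < s := lt_min one_pos (div_pos (by linarith) hpq)
    have hs1 : s ≤ 1 := min_le_left _ _
    have hsM : s * ‖p - q‖ ≤ -M := by
      rw [← le_div_iff₀ hpq]; exact min_le_right _ _
    have hx : q + s • (p - q) ∈ H := by
      by_contra hx
      obtain ⟨θ, hθ, hg⟩ := exists_gap_pos_window hconv hc hne hx m
      have h1 : gap H (q + s • (p - q)) θ = gap H q θ + s * ⟪p - q, dir θ⟫ := by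
        simp only [gap, inner_add_left, inner_smul_left, conj_trivial]; ring
      rw [h1] at hg
      have h2 := gap_nonpos_of_mem hc hq θ
      have h3 : 0 < ⟪p - q, dir θ⟫ := (mul_pos_iff_of_pos_left hs).1 (by linarith)
      rw [abs_le] at hθ
      have h4 : min (gap H q θ) ⟪p - q, dir θ⟫ ≤ M :=
        hmax (⟨by linarith, by linarith⟩ : θ ∈ Icc (m - Real.pi) (m + Real.pi))
      have h5 : gap H q θ ≤ M := by
        rcases min_le_iff.1 h4 with h | h
        · exact h
        · linarith
      have h6 : ⟪p - q, dir θ⟫ ≤ ‖p - q‖ := by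
        simpa using real_inner_le_norm (p - q) (dir θ)
      have h7 := mul_le_mul_of_nonneg_left h6 hs.le
      linarith
    have hseg : q + s • (p - q) ∈ segment ℝ p q := by
      rw [segment_symm, segment_eq_image']
      exact ⟨s, ⟨hs.le, hs1⟩, rfl⟩
    have := hvis _ hseg hx
    rw [add_eq_left, smul_eq_zero] at this
    rcases this with h | h
    · exact hs.ne' h
    · rw [h, norm_zero] at hpq; exact lt_irrefl _ hpq
  obtain ⟨h1, h2⟩ := le_min_iff.1 hM
  have hp : 0 ≤ gap H p φ := by
    have : gap H p φ = gap H q φ + ⟪p - q, dir φ⟫ := by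
      simp only [gap, inner_sub_left]; ring
    linarith
  refine ⟨φ, ?_, mem_face_iff_gap.2 ⟨hq, le_antisymm (gap_nonpos_of_mem hc hq φ) h1⟩⟩
  have h3 : |φ - m| ≤ β := by
    by_contra h
    have := hw.gap_neg φ (not_le.1 h) (abs_le.2 ⟨by linarith [hφ.1], by linarith [hφ.2]⟩)
    linarith
  rw [abs_le] at h3
  exact ⟨by linarith, by linarith⟩

lemma mem_facingArc (hw : IsWedge H p m β) (hc : IsCompact H) {q : Plane} {θ : ℝ}
    (hq : q ∈ face H θ) (hθ : |θ - m| < β) : q ∈ facingArc H p := by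
  refine ⟨hq.1, fun x hx hxH => ?_⟩
  rw [segment_symm, segment_eq_image'] at hx
  obtain ⟨s, hs, rfl⟩ := hx
  have h1 := hw.gap_pos θ hθ
  have h2 := gap_nonpos_of_mem hc hxH θ
  have h3 : gap H (q + s • (p - q)) θ = s * gap H p θ := by
    simp only [gap, inner_add_left, inner_smul_left, conj_trivial, inner_sub_left, hq.2]; ring
  simp only at h2
  rw [h3] at h2
  have h4 : s ≤ 0 := by
    by_contra h
    exact absurd (mul_pos (not_le.1 h) h1) (not_lt.2 h2)
  rw [le_antisymm h4 hs.1]; simp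

/-- The face lies on a line through `p`, on one side of it, so the nearer of two points hides the
farther one. -/
lemma facingArc_inter_right (hw : IsWedge H p m β) (hc : IsCompact H) :
    (facingArc H p ∩ face H (m - β)).Subsingleton := by
  have key : ∀ x ∈ facingArc H p ∩ face H (m - β), ∀ y ∈ facingArc H p ∩ face H (m - β),
      ⟪x, ort (m - β)⟫ ≤ ⟪y, ort (m - β)⟫ → x = y := by
    rintro x ⟨hx, hx'⟩ y ⟨hy, hy'⟩ h
    obtain ⟨h1, h2⟩ := hw.sub_eq_right hc hx'
    obtain ⟨h3, h4⟩ := hw.sub_eq_right hc hy'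
    refine (hx.2 y ?_ hy.1).symm
    rw [segment_eq_image']
    refine ⟨⟪p - y, ort (m - β)⟫ / ⟪p - x, ort (m - β)⟫, ⟨(div_pos h4 h2).le, ?_⟩, ?_⟩
    · rw [div_le_one h2, inner_sub_left, inner_sub_left]; linarith
    · simp only
      rw [← neg_sub p x]
      nth_rewrite 2 [h1]
      rw [smul_neg, smul_smul, div_mul_cancel₀ _ h2.ne', ← h3]
      abel
  intro x hx y hy
  rcases le_total ⟪x, ort (m - β)⟫ ⟪y, ort (m - β)⟫ with h | h
  · exact key x hx y hy h
  · exact (key y hy x hx h).symm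

lemma facingArc_inter_left (hw : IsWedge H p m β) (hc : IsCompact H) :
    (facingArc H p ∩ face H (m + β)).Subsingleton := by
  have key : ∀ x ∈ facingArc H p ∩ face H (m + β), ∀ y ∈ facingArc H p ∩ face H (m + β),
      ⟪y, ort (m + β)⟫ ≤ ⟪x, ort (m + β)⟫ → x = y := by
    rintro x ⟨hx, hx'⟩ y ⟨hy, hy'⟩ h
    obtain ⟨h1, h2⟩ := hw.sub_eq_left hc hx'
    obtain ⟨h3, h4⟩ := hw.sub_eq_left hc hy'
    refine (hx.2 y ?_ hy.1).symm
    rw [segment_eq_image']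
    refine ⟨⟪y - p, ort (m + β)⟫ / ⟪x - p, ort (m + β)⟫, ⟨(div_pos h4 h2).le, ?_⟩, ?_⟩
    · rw [div_le_one h2, inner_sub_left, inner_sub_left]; linarith
    · simp only
      nth_rewrite 2 [h1]
      rw [smul_smul, div_mul_cancel₀ _ h2.ne', ← h3]
      abel
  intro x hx y hy
  rcases le_total ⟪y, ort (m + β)⟫ ⟪x, ort (m + β)⟫ with h | h
  · exact key x hx y hy h
  · exact (key y hy x hx h).symm

/-- A common point `T` would make `p - T` a positive multiple of both `ort (m - β)` and `-ort (m +
β)`, whose components along `ort m` have opposite signs when `cos β > 0`. -/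
lemma disjoint_faces (hw : IsWedge H p m β) (hc : IsCompact H) (hβ : β < Real.pi / 2) :
    Disjoint (face H (m - β)) (face H (m + β)) := by
  rw [Set.disjoint_left]
  intro T h1 h2
  obtain ⟨e1, r1⟩ := hw.sub_eq_right hc h1
  obtain ⟨e2, r2⟩ := hw.sub_eq_left hc h2
  have hcos : 0 < Real.cos β := Real.cos_pos_of_mem_Ioo ⟨by linarith [hw.pos, Real.pi_pos], hβ⟩
  have k1 := congrArg (fun x => ⟪x, ort m⟫) e1
  have k2 := congrArg (fun x => ⟪x, ort m⟫) e2
  simp only [inner_smul_left, inner_ort_ort, conj_trivial, sub_sub_cancel, sub_add_cancel_left,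
    Real.cos_neg] at k1 k2
  have k3 : ⟪p - T, ort m⟫ + ⟪T - p, ort m⟫ = 0 := by rw [← inner_add_left]; simp
  have := mul_pos r1 hcos
  have := mul_pos r2 hcos
  linarith

lemma facingArc_union (hw : IsWedge H p m β) (hconv : Convex ℝ H) (hc : IsCompact H) :
    facingArc H p ∪ face H (m - β) ∪ face H (m + β) = normalArc H (m - β) (m + β) := by
  have hp := hw.pos
  ext x
  constructor
  · rintro ((h | h) | h)
    · exact hw.facingArc_subset hconv hc h
    · exact ⟨m - β, ⟨le_rfl, by linarith⟩, h⟩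
    · exact ⟨m + β, ⟨by linarith, le_rfl⟩, h⟩
  · rintro ⟨θ, hθ, hx⟩
    rcases eq_or_lt_of_le hθ.1 with h1 | h1
    · subst h1; exact Or.inl (Or.inr hx)
    rcases eq_or_lt_of_le hθ.2 with h2 | h2
    · subst h2; exact Or.inr hx
    · exact Or.inl (Or.inl (hw.mem_facingArc hc hx (abs_lt.2 ⟨by linarith, by linarith⟩)))

lemma hlen_real_subsingleton {S : Set Plane} (hS : S.Subsingleton) : hlen.real S = 0 := by
  have := Measure.nullSingletonClass_hausdorff Plane (d := 1) one_pos
  rw [measureReal_def, hS.measure_zero, ENNReal.toReal_zero]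

/-- `normalArc` contains both end faces entirely, while the visible arc has at most one point of
each. Removing the lengths of these faces exchanges `tauMax` and `tauMin` in `arcFormula`. -/
lemma hlen_facingArc (hw : IsWedge H p m β) (hconv : Convex ℝ H) (hc : IsCompact H)
    (hne : H.Nonempty) (hβ : β < Real.pi / 2) : hlen.real (facingArc H p)
      = tauMin H (m + β) - tauMax H (m - β) + ∫ θ in (m - β)..(m + β), supp H θ := by
  have hp := hw.pos
  have hU := hw.facingArc_union hconv hc
  have hfin : hlen (normalArc H (m - β) (m + β)) ≠ ⊤ :=
    (hlen_normalArc_lt_top hc hne (by linarith) (by linarith)).ne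
  have hm : ∀ S ⊆ normalArc H (m - β) (m + β), hlen S ≠ ⊤ := fun S hS =>
    ne_top_of_le_ne_top hfin (measure_mono hS)
  rw [← hU] at hm
  have h1 := measureReal_union_add_inter (μ := hlen) (s := facingArc H p)
    (isCompact_face hc (m - β)).measurableSet (hm _ fun x hx => Or.inl (Or.inl hx))
    (hm _ fun x hx => Or.inl (Or.inr hx))
  have h2 := measureReal_union_add_inter (μ := hlen) (s := facingArc H p ∪ face H (m - β))
    (isCompact_face hc (m + β)).measurableSet (hm _ fun x hx => Or.inl hx)
    (hm _ fun x hx => Or.inr hx)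
  rw [union_inter_distrib_right, (hw.disjoint_faces hc hβ).inter_eq, union_empty,
    hlen_real_subsingleton (hw.facingArc_inter_left hc), hU,
    hlen_normalArc hconv hc hne (by linarith) (by linarith), hlen_face hconv hc hne] at h2
  rw [hlen_real_subsingleton (hw.facingArc_inter_right hc), hlen_face hconv hc hne] at h1
  rw [arcFormula] at h2
  linarith

end IsWedge

/-! ### The excess length of the string -/

/-- The excess of the string length over the perimeter of `H`, as an integral over directions. -/
noncomputable def excess (H : Set Plane) (p : Plane) : ℝ :=
  ∫ θ in (-Real.pi)..Real.pi, max (gap H p θ) 0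

lemma continuous_posGap (hc : IsCompact H) (p : Plane) :
    Continuous fun θ => max (gap H p θ) 0 :=
  (continuous_gap_right hc p).max continuous_const

lemma integrable_posGap (hc : IsCompact H) (p : Plane) (a b : ℝ) :
    IntervalIntegrable (fun θ => max (gap H p θ) 0) volume a b :=
  (continuous_posGap hc p).intervalIntegrable _ _

lemma excess_eq_window (p : Plane) (m : ℝ) :
    excess H p = ∫ θ in (m - Real.pi)..(m + Real.pi), max (gap H p θ) 0 := by
  have hp : Function.Periodic (fun θ => max (gap H p θ) 0) (2 * Real.pi) := fun θ => by
    simp only [gap_add_two_pi]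
  have := hp.intervalIntegral_add_eq (-Real.pi) (m - Real.pi)
  rw [show -Real.pi + 2 * Real.pi = Real.pi by ring,
    show m - Real.pi + 2 * Real.pi = m + Real.pi by ring] at this
  exact this

lemma integral_window {f g : ℝ → ℝ} {m β : ℝ} (hβ : 0 ≤ β) (hβ' : β ≤ Real.pi)
    (h1 : ∀ θ, |θ - m| < β → f θ = g θ) (h2 : ∀ θ, β < |θ - m| → |θ - m| ≤ Real.pi → f θ = 0) :
    ∫ θ in (m - Real.pi)..(m + Real.pi), f θ = ∫ θ in (m - β)..(m + β), g θ := by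
  have hpi := Real.pi_pos
  rw [intervalIntegral.integral_of_le (by linarith), intervalIntegral.integral_of_le (by linarith)]
  have hsub : Ioc (m - β) (m + β) ⊆ Ioc (m - Real.pi) (m + Real.pi) :=
    Ioc_subset_Ioc (by linarith) (by linarith)
  rw [← inter_eq_self_of_subset_right hsub, ← setIntegral_indicator measurableSet_Ioc]
  refine setIntegral_congr_ae measurableSet_Ioc ?_
  have n1 : ∀ᵐ θ : ℝ, θ ≠ m - β := by simp [ae_iff]
  have n2 : ∀ᵐ θ : ℝ, θ ≠ m + β := by simp [ae_iff]
  filter_upwards [n1, n2] with θ hθ1 hθ2 hθ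
  by_cases h : θ ∈ Ioc (m - β) (m + β)
  · rw [indicator_of_mem h]
    exact h1 θ (abs_lt.2 ⟨by linarith [h.1], by linarith [lt_of_le_of_ne h.2 hθ2]⟩)
  · rw [indicator_of_notMem h]
    refine h2 θ ?_ (abs_le.2 ⟨by linarith [hθ.1], by linarith [hθ.2]⟩)
    by_contra h3
    rw [not_lt, abs_le] at h3
    exact h ⟨lt_of_le_of_ne (by linarith) hθ1.symm, by linarith⟩

lemma IsWedge.excess_eq {p : Plane} {m β : ℝ} (hw : IsWedge H p m β) (hc : IsCompact H) :
    excess H p = ⟪p, ort (m - β)⟫ - ⟪p, ort (m + β)⟫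
      - ∫ θ in (m - β)..(m + β), supp H θ := by
  have hpi := Real.pi_pos
  rw [excess_eq_window p m, integral_window hw.pos.le (by linarith [hw.le])
    (fun θ h => max_eq_left (hw.gap_pos θ h).le) (fun θ h h' => max_eq_right (hw.gap_neg θ h h').le)]
  simp only [gap]
  rw [intervalIntegral.integral_sub ((continuous_const.inner continuous_dir).intervalIntegrable _ _)
    ((continuous_supp hc).intervalIntegrable _ _), integral_inner_dir]

/-- The two supporting lines have opposite normals and both pass through `p`, so they coincide and
contain `H`. -/
lemma IsWedge.mem_faces_of_flat {p : Plane} {m : ℝ} (hw : IsWedge H p m (Real.pi / 2))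
    (hc : IsCompact H) {q : Plane} (hq : q ∈ H) :
    q ∈ face H (m - Real.pi / 2) ∧ q ∈ face H (m + Real.pi / 2) := by
  have h1 := hw.left
  have h2 := hw.right
  have e : m + Real.pi / 2 = m - Real.pi / 2 + Real.pi := by ring
  have h3 := inner_le_supp hc hq (m - Real.pi / 2)
  have h4 := inner_le_supp hc hq (m + Real.pi / 2)
  rw [gap, sub_eq_zero] at h1 h2
  rw [← h1] at h3
  rw [← h2] at h4
  refine ⟨⟨hq, ?_⟩, ⟨hq, ?_⟩⟩
  · rw [← h1]
    rw [e, dir_add_pi, inner_neg_right, inner_neg_right] at h4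
    linarith
  · rw [← h2]
    rw [e, dir_add_pi, inner_neg_right, inner_neg_right] at h4 ⊢
    linarith

/-- On this half turn of directions the support function is that of the point `T` of `H` nearest to
`p`. The string runs from `p` to `T` and back, which explains the factor 2. -/
lemma IsWedge.excess_eq_of_flat {p : Plane} {m : ℝ} (hw : IsWedge H p m (Real.pi / 2))
    (hc : IsCompact H) (hne : H.Nonempty) :
    excess H p = 2 * (⟪p, ort (m - Real.pi / 2)⟫ - tauMax H (m - Real.pi / 2)) := by
  set a := m - Real.pi / 2 with ha
  have hb : m + Real.pi / 2 = a + Real.pi := by rw [ha]; ring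
  obtain ⟨T, hT, hT'⟩ := exists_inner_ort_eq_tauMax hc hne a
  rw [hw.excess_eq hc, ← ha, hb]
  have : ∫ θ in a..(a + Real.pi), supp H θ = ∫ θ in a..(a + Real.pi), ⟪T, dir θ⟫ := by
    refine intervalIntegral.integral_congr fun θ hθ => ?_
    rw [uIcc_of_le (by linarith [Real.pi_pos])] at hθ
    refine le_antisymm (supp_le hc hne fun x hx => ?_) (inner_le_supp hc hT.1 θ)
    have hx' := (hw.mem_faces_of_flat hc hx).1
    rw [inner_frame' x a θ, inner_frame' T a θ, hx'.2, hT.2]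
    have := mul_le_mul_of_nonneg_right ((inner_ort_le_tauMax hc hx').trans hT'.ge)
      (Real.sin_nonneg_of_nonneg_of_le_pi (x := θ - a) (by linarith [hθ.1]) (by linarith [hθ.2]))
    linarith
  rw [this, integral_inner_dir, ort_add_pi, inner_neg_right, inner_neg_right, hT']
  ring

/-- The string length exceeds the perimeter by the integral of the gap over all directions. -/
theorem stringPotential_eq (hconv : Convex ℝ H) (hc : IsCompact H) (hne : H.Nonempty) {p : Plane}
    (hp : p ∉ H) : stringPotential H p = convexPerimeter H + excess H p := by
  obtain ⟨m, β, hw⟩ := exists_isWedge hconv hc hne hp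
  unfold stringPotential
  rw [hw.leftTangentPoints_eq hc hne, hw.rightTangentPoints_eq hc hne, hw.infDist_left hc hne,
    hw.infDist_right hc hne]
  change _ + (_ - hlen.real (facingArc H p)) = _
  rcases eq_or_lt_of_le hw.le with h | h
  · subst h
    have hS : (facingArc H p).Subsingleton := fun x hx y hy =>
      hw.facingArc_inter_right hc ⟨hx, (hw.mem_faces_of_flat hc hx.1).1⟩
        ⟨hy, (hw.mem_faces_of_flat hc hy.1).1⟩
    have e : ort (m + Real.pi / 2) = -ort (m - Real.pi / 2) := by
      rw [← ort_add_pi]; congr 1; ring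
    have ht : tauMin H (m + Real.pi / 2) = -tauMax H (m - Real.pi / 2) := by
      obtain ⟨T, hT, hT'⟩ := exists_inner_ort_eq_tauMax hc hne (m - Real.pi / 2)
      obtain ⟨S, hS, hS'⟩ := exists_inner_ort_eq_tauMin hc hne (m + Real.pi / 2)
      have h1 := inner_ort_le_tauMax hc (hw.mem_faces_of_flat hc hS.1).1
      have h2 := tauMin_le_inner_ort hc (hw.mem_faces_of_flat hc hT.1).2
      rw [e, inner_neg_right] at hS' h2
      linarith
    rw [IsWedge.hlen_real_subsingleton hS, hw.excess_eq_of_flat hc hne, e, ht, inner_neg_right]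
    ring
  · rw [hw.hlen_facingArc hconv hc hne h, hw.excess_eq hc]
    ring

/-! ### Convexity, growth and continuity of the excess -/

lemma gap_combo (x y : Plane) {a b : ℝ} (hab : a + b = 1) (θ : ℝ) :
    gap H (a • x + b • y) θ = a * gap H x θ + b * gap H y θ := by
  simp only [gap, inner_add_left, inner_smul_left, conj_trivial]
  linear_combination (supp H θ) * hab

lemma posGap_combo_le (x y : Plane) {a b : ℝ} (ha : 0 ≤ a) (hb : 0 ≤ b) (hab : a + b = 1) (θ : ℝ) :
    max (gap H (a • x + b • y) θ) 0 ≤ a * max (gap H x θ) 0 + b * max (gap H y θ) 0 := by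
  rw [gap_combo x y hab]
  refine max_le (add_le_add ?_ ?_) (by positivity)
  · exact mul_le_mul_of_nonneg_left (le_max_left _ _) ha
  · exact mul_le_mul_of_nonneg_left (le_max_left _ _) hb

lemma excess_combo (hc : IsCompact H) (x y : Plane) (a b m : ℝ) :
    a * excess H x + b * excess H y = ∫ θ in (m - Real.pi)..(m + Real.pi),
      (a * max (gap H x θ) 0 + b * max (gap H y θ) 0) := by
  rw [intervalIntegral.integral_add ((integrable_posGap hc x _ _).const_mul a)
    ((integrable_posGap hc y _ _).const_mul b), intervalIntegral.integral_const_mul,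
    intervalIntegral.integral_const_mul, ← excess_eq_window, ← excess_eq_window]

theorem convexOn_excess (hc : IsCompact H) : ConvexOn ℝ univ (excess H) := by
  refine ⟨convex_univ, fun x _ y _ a b ha hb hab => ?_⟩
  rw [smul_eq_mul, smul_eq_mul, excess_combo hc x y a b 0, excess_eq_window _ 0]
  refine intervalIntegral.integral_mono_on (by linarith [Real.pi_pos])
    (integrable_posGap hc _ _ _) ?_ fun θ _ => posGap_combo_le x y ha hb hab θ
  exact ((integrable_posGap hc x _ _).const_mul a).add ((integrable_posGap hc y _ _).const_mul b)

lemma excess_nonneg (p : Plane) : 0 ≤ excess H p :=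
  intervalIntegral.integral_nonneg (by linarith [Real.pi_pos]) fun _ _ => le_max_right _ _

lemma excess_of_mem (hc : IsCompact H) {p : Plane} (hp : p ∈ H) : excess H p = 0 := by
  unfold excess
  rw [intervalIntegral.integral_congr (g := fun _ => 0)
    fun θ _ => max_eq_right (gap_nonpos_of_mem hc hp θ)]
  simp

/-- This is the excess for the set `{0}`, with a wedge of half-width `π / 2` around the direction of
`w`. -/
lemma integral_pos_inner (w : Plane) :
    ∫ θ in (-Real.pi)..Real.pi, max ⟪w, dir θ⟫ 0 = 2 * ‖w‖ := by
  rcases eq_or_ne w 0 with rfl | hw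
  · simp
  have hn : 0 < ‖w‖ := norm_pos_iff.2 hw
  have hpi := Real.pi_pos
  have hs : ∀ θ, supp {(0 : Plane)} θ = 0 := fun θ => by simp [supp]
  have hg : ∀ θ, gap {(0 : Plane)} w θ = ⟪w, dir θ⟫ := fun θ => by rw [gap, hs, sub_zero]
  obtain ⟨φ, -, hφ⟩ := exists_dir_eq (w := ‖w‖⁻¹ • w)
    (by rw [norm_smul, norm_inv, norm_norm, inv_mul_cancel₀ hn.ne']) 0
  have hw' : w = ‖w‖ • dir φ := by rw [← hφ, smul_inv_smul₀ hn.ne']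
  have hd : ∀ θ, ⟪w, dir θ⟫ = ‖w‖ * Real.cos (θ - φ) := fun θ => by
    rw [hw', inner_smul_left, inner_dir_dir, ← hw']; simp
  have hW : IsWedge {(0 : Plane)} w φ (Real.pi / 2) := by
    refine ⟨by linarith, le_rfl, ?_, ?_, fun θ h => ?_, fun θ h h' => ?_⟩
    · rw [hg, hd, sub_sub_cancel_left, Real.cos_neg, Real.cos_pi_div_two, mul_zero]
    · rw [hg, hd, add_sub_cancel_left, Real.cos_pi_div_two, mul_zero]
    · rw [abs_lt] at h
      rw [hg, hd]; exact mul_pos hn (Real.cos_pos_of_mem_Ioo ⟨h.1, h.2⟩)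
    · rw [hg, hd, ← Real.cos_abs]
      exact mul_neg_of_pos_of_neg hn (Real.cos_neg_of_pi_div_two_lt_of_lt h (by linarith))
  have := hW.excess_eq isCompact_singleton
  simp only [excess, hg, hs, intervalIntegral.integral_zero, sub_zero] at this
  rw [this, hw', inner_smul_left, inner_smul_left, inner_dir_ort, inner_dir_ort,
    sub_sub_cancel_left, add_sub_cancel_left, Real.sin_neg, Real.sin_pi_div_two, ← hw']
  simp; ring

lemma excess_le_add (hc : IsCompact H) (p q : Plane) :
    excess H p ≤ excess H q + 2 * ‖p - q‖ := by
  have hi : IntervalIntegrable (fun θ => max ⟪p - q, dir θ⟫ 0) volume (-Real.pi) Real.pi :=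
    ((continuous_const.inner continuous_dir).max continuous_const).intervalIntegrable _ _
  rw [← integral_pos_inner, excess, excess, ← intervalIntegral.integral_add
    (integrable_posGap hc q _ _) hi]
  refine intervalIntegral.integral_mono_on (by linarith [Real.pi_pos]) (integrable_posGap hc p _ _)
    ((integrable_posGap hc q _ _).add hi) fun θ _ => ?_
  have e : gap H p θ = gap H q θ + ⟪p - q, dir θ⟫ := by simp only [gap, inner_sub_left]; ring
  rw [e]
  exact max_le (add_le_add (le_max_left _ _) (le_max_left _ _))
    (add_nonneg (le_max_right _ _) (le_max_right _ _))

lemma continuous_excess (hc : IsCompact H) : Continuous (excess H) := by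
  have : LipschitzWith 2 (excess H) := LipschitzWith.of_le_add_mul 2 fun x y => by
    rw [dist_eq_norm]; exact excess_le_add hc x y
  exact this.continuous

/-- Growth at infinity, needed for compactness of the table: in each direction `⟪p - c, dir θ⟫`
exceeds the gap of `p` by at most `D`. -/
lemma norm_sub_le_excess (hc : IsCompact H) {D : ℝ} (hD : ∀ x ∈ H, ∀ y ∈ H, ‖x - y‖ ≤ D)
    {c : Plane} (hcH : c ∈ H) (p : Plane) : 2 * ‖p - c‖ ≤ excess H p + 2 * Real.pi * D := by
  have hD0 : 0 ≤ D := (norm_nonneg _).trans (hD c hcH c hcH)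
  have hi : IntervalIntegrable (fun θ => max ⟪p - c, dir θ⟫ 0) volume (-Real.pi) Real.pi :=
    ((continuous_const.inner continuous_dir).max continuous_const).intervalIntegrable _ _
  have hk : ∫ _ in (-Real.pi)..Real.pi, D = 2 * Real.pi * D := by
    rw [intervalIntegral.integral_const, smul_eq_mul]; ring
  rw [← integral_pos_inner, ← hk, excess, ← intervalIntegral.integral_add
    (integrable_posGap hc p _ _) (by simp)]
  refine intervalIntegral.integral_mono_on (by linarith [Real.pi_pos]) hi
    ((integrable_posGap hc p _ _).add (by simp)) fun θ _ => ?_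
  obtain ⟨x, hx, hx'⟩ := face_nonempty hc ⟨c, hcH⟩ θ
  have h1 : ⟪x - c, dir θ⟫ ≤ D := by
    refine (real_inner_le_norm _ _).trans ?_
    simpa using hD x hx c hcH
  refine max_le ?_ (add_nonneg (le_max_right _ _) hD0)
  have h2 := le_max_left (gap H p θ) 0
  rw [inner_sub_left] at h1 ⊢
  rw [hx'] at h1
  have h3 : gap H p θ = ⟪p, dir θ⟫ - supp H θ := rfl
  linarith

/-! ### The gradient of the excess length -/

/-- The integrand is 1-Lipschitz in the point. Except at the null set `θ = m ± β` it is near `p`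
either affine with gradient `dir θ` or zero, so the gradient is the integral of `dir` over the
wedge. -/
theorem IsWedge.hasFDerivAt_excess {p : Plane} {m β : ℝ} (hw : IsWedge H p m β)
    (hc : IsCompact H) :
    HasFDerivAt (excess H) (innerSL ℝ (ort (m - β) - ort (m + β))) p := by
  have hpi := Real.pi_pos
  have hβ := hw.le
  let F' : ℝ → Plane →L[ℝ] ℝ := (Ioo (m - β) (m + β)).indicator fun θ => innerSL ℝ (dir θ)
  have hcd : Continuous fun θ => innerSL ℝ (dir θ) := (innerSL ℝ).continuous.comp continuous_dir
  have key := intervalIntegral.hasFDerivAt_integral_of_dominated_loc_of_lip (𝕜 := ℝ) (μ := volume)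
    (a := m - Real.pi) (b := m + Real.pi) (F := fun x θ => max (gap H x θ) 0) (F' := F') (x₀ := p)
    (s := univ) (bound := fun _ => 1) univ_mem
    (Eventually.of_forall fun x => (continuous_posGap hc x).aestronglyMeasurable)
    (integrable_posGap hc p _ _)
    (hcd.aestronglyMeasurable.indicator measurableSet_Ioo)
    (by
      refine Eventually.of_forall fun θ _ => LipschitzOnWith.of_dist_le_mul fun x _ y _ => ?_
      rw [Real.dist_eq, dist_eq_norm]
      refine (abs_max_sub_max_le_abs _ _ _).trans ?_
      have : gap H x θ - gap H y θ = ⟪x - y, dir θ⟫ := by simp only [gap, inner_sub_left]; ring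
      rw [this]
      simpa using abs_real_inner_le_norm (x - y) (dir θ))
    (by simp)
    (by
      have n1 : ∀ᵐ θ : ℝ, θ ≠ m - β := by simp [ae_iff]
      have n2 : ∀ᵐ θ : ℝ, θ ≠ m + β := by simp [ae_iff]
      filter_upwards [n1, n2] with θ hθ1 hθ2 hθ
      rw [uIoc_of_le (by linarith)] at hθ
      have hcont : ContinuousAt (fun x => gap H x θ) p := by
        unfold gap; fun_prop
      by_cases h : θ ∈ Ioo (m - β) (m + β)
      · simp only [F', indicator_of_mem h]
        have hpos := hw.gap_pos θ (abs_lt.2 ⟨by linarith [h.1], by linarith [h.2]⟩)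
        have h1 : HasFDerivAt (fun x => innerSL ℝ (dir θ) x - supp H θ) (innerSL ℝ (dir θ)) p :=
          (innerSL ℝ (dir θ)).hasFDerivAt.sub_const _
        refine h1.congr_of_eventuallyEq ?_
        filter_upwards [hcont.eventually (lt_mem_nhds hpos)] with x hx
        rw [max_eq_left hx.le, innerSL_apply_apply, real_inner_comm, gap]
      · simp only [F', indicator_of_notMem h]
        have hneg : gap H p θ < 0 := by
          refine hw.gap_neg θ ?_ (abs_le.2 ⟨by linarith [hθ.1], by linarith [hθ.2]⟩)
          by_contra h3
          rw [not_lt, abs_le] at h3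
          exact h ⟨lt_of_le_of_ne (by linarith) hθ1.symm, lt_of_le_of_ne (by linarith) hθ2⟩
        refine (hasFDerivAt_const (0 : ℝ) p).congr_of_eventuallyEq ?_
        filter_upwards [hcont.eventually (gt_mem_nhds hneg)] with x hx
        rw [max_eq_right hx.le])
  have e1 : (fun x => ∫ θ in (m - Real.pi)..(m + Real.pi), max (gap H x θ) 0) = excess H :=
    funext fun x => (excess_eq_window x m).symm
  rw [e1] at key
  suffices e2 : innerSL ℝ (ort (m - β) - ort (m + β))
      = ∫ θ in (m - Real.pi)..(m + Real.pi), F' θ by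
    rw [e2]; exact key.2
  refine ContinuousLinearMap.ext fun y => ?_
  rw [ContinuousLinearMap.intervalIntegral_apply key.1,
    integral_window (f := fun θ => F' θ y) (g := fun θ => ⟪y, dir θ⟫) hw.pos.le (by linarith),
    integral_inner_dir, innerSL_apply_apply, inner_sub_left, real_inner_comm,
    real_inner_comm (ort (m + β))]
  · intro θ h
    rw [abs_lt] at h
    have : θ ∈ Ioo (m - β) (m + β) := ⟨by linarith, by linarith⟩
    simp only [F', indicator_of_mem this, innerSL_apply_apply, real_inner_comm]
  · intro θ h _
    have : θ ∉ Ioo (m - β) (m + β) := fun h' =>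
      absurd (abs_lt.2 ⟨by linarith [h'.1], by linarith [h'.2]⟩ : |θ - m| < β) (not_lt.2 h.le)
    simp [F', indicator_of_notMem this]

/-- The gradient of the string length. -/
noncomputable def pull (H : Set Plane) (p : Plane) : Plane := gradient (excess H) p

lemma IsWedge.pull_eq {p : Plane} {m β : ℝ} (hw : IsWedge H p m β) (hc : IsCompact H) :
    pull H p = ort (m - β) - ort (m + β) := by
  have h : HasGradientAt (excess H) (ort (m - β) - ort (m + β)) p := hw.hasFDerivAt_excess hc
  exact h.gradient

lemma ort_sub_ort (m β : ℝ) : ort (m - β) - ort (m + β) = (2 * Real.sin β) • dir m := by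
  apply plane_ext
  · simp [Real.sin_add, Real.sin_sub]; ring
  · simp [Real.cos_add, Real.cos_sub]; ring

lemma IsWedge.pull_eq_smul {p : Plane} {m β : ℝ} (hw : IsWedge H p m β) (hc : IsCompact H) :
    pull H p = (2 * Real.sin β) • dir m := by rw [hw.pull_eq hc, ort_sub_ort]

theorem hasFDerivAt_excess (hconv : Convex ℝ H) (hc : IsCompact H) (hne : H.Nonempty) {p : Plane}
    (hp : p ∉ H) : HasFDerivAt (excess H) (innerSL ℝ (pull H p)) p := by
  obtain ⟨m, β, hw⟩ := exists_isWedge hconv hc hne hp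
  rw [hw.pull_eq hc]
  exact hw.hasFDerivAt_excess hc

/-- The gradient inequality for the convex function `excess H`. -/
lemma inner_pull_le (hconv : Convex ℝ H) (hc : IsCompact H) (hne : H.Nonempty) {p : Plane}
    (hp : p ∉ H) (x : Plane) : ⟪pull H p, x - p⟫ ≤ excess H x - excess H p := by
  have hd : HasDerivAt (fun t : ℝ => excess H (p + t • (x - p))) ⟪pull H p, x - p⟫ 0 := by
    have h1 : HasDerivAt (fun t : ℝ => p + t • (x - p)) (x - p) 0 := by
      simpa using ((hasDerivAt_id (0 : ℝ)).smul_const (x - p)).const_add p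
    have h2 : HasFDerivAt (excess H) (innerSL ℝ (pull H p)) (p + (0 : ℝ) • (x - p)) := by
      simpa using hasFDerivAt_excess hconv hc hne hp
    exact h2.comp_hasDerivAt 0 h1
  have hcv : ConvexOn ℝ univ (fun t : ℝ => excess H (p + t • (x - p))) := by
    refine ⟨convex_univ, fun s _ t _ a b ha hb hab => ?_⟩
    have := (convexOn_excess hc).2 (mem_univ (p + s • (x - p))) (mem_univ (p + t • (x - p))) ha hb hab
    rwa [show a • (p + s • (x - p)) + b • (p + t • (x - p))
      = (a + b) • p + (a • s + b • t) • (x - p) by simp only [smul_eq_mul]; module,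
      hab, one_smul] at this
  have := hcv.le_slope_of_hasDerivAt (mem_univ 0) (mem_univ 1) one_pos hd
  simpa [slope_def_field] using this

/-! ### The table -/

/-- The table bounded by the string curve. -/
def table (H : Set Plane) (lam : ℝ) : Set Plane := {p | excess H p ≤ 2 * lam}

lemma isClosed_table (hc : IsCompact H) (lam : ℝ) : IsClosed (table H lam) :=
  isClosed_le (continuous_excess hc) continuous_const

lemma isCompact_table (hc : IsCompact H) (hne : H.Nonempty) (lam : ℝ) :
    IsCompact (table H lam) := by
  obtain ⟨D, hD⟩ := exists_norm_sub_le hc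
  obtain ⟨c, hcH⟩ := hne
  refine Metric.isCompact_of_isClosed_isBounded (isClosed_table hc lam) ?_
  refine (Metric.isBounded_closedBall (x := c) (r := lam + Real.pi * D)).subset fun p hp => ?_
  have h1 := norm_sub_le_excess hc hD hcH p
  have h2 : excess H p ≤ 2 * lam := hp
  rw [Metric.mem_closedBall, dist_eq_norm]
  linarith

/-- Convexity together with the zero at `c`: along rays from `H` the excess grows at least linearly.
Hence level sets at positive values have no interior and meet each ray once. -/
lemma mul_excess_le (hc : IsCompact H) {c : Plane} (hcH : c ∈ H) (w : Plane) {t : ℝ}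
    (ht : 1 ≤ t) : t * excess H (c + w) ≤ excess H (c + t • w) := by
  have ht0 : 0 < t := by linarith
  have := (convexOn_excess hc).2 (mem_univ c) (mem_univ (c + t • w))
    (sub_nonneg.2 (inv_le_one_of_one_le₀ ht)) (inv_nonneg.2 ht0.le) (sub_add_cancel 1 t⁻¹)
  rw [excess_of_mem hc hcH, smul_zero, zero_add, smul_add, inv_smul_smul₀ ht0.ne', sub_smul,
    one_smul, smul_eq_mul] at this
  rw [show c - t⁻¹ • c + (t⁻¹ • c + w) = c + w by abel] at this
  rwa [← le_div_iff₀' ht0, div_eq_inv_mul]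

variable {lam : ℝ}

lemma interior_table (hc : IsCompact H) (hne : H.Nonempty) (hlam : 0 < lam) :
    interior (table H lam) = {p | excess H p < 2 * lam} := by
  apply Subset.antisymm
  · intro p hp
    have hp' : excess H p ≤ 2 * lam := interior_subset (s := table H lam) hp
    refine lt_of_le_of_ne hp' fun h => ?_
    obtain ⟨c, hcH⟩ := hne
    have h1 : Tendsto (fun t : ℝ => c + t • (p - c)) (𝓝[>] 1) (𝓝 p) := by
      have : Continuous fun t : ℝ => c + t • (p - c) := by fun_prop
      have h2 := this.tendsto 1
      simp only [one_smul, add_sub_cancel] at h2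
      exact h2.mono_left nhdsWithin_le_nhds
    obtain ⟨t, ht, ht1⟩ := ((h1.eventually (mem_interior_iff_mem_nhds.1 hp)).and
      self_mem_nhdsWithin).exists
    have h2 := mul_excess_le hc hcH (p - c) (le_of_lt ht1)
    rw [add_sub_cancel, h] at h2
    have h3 : excess H (c + t • (p - c)) ≤ 2 * lam := ht
    have h4 : (1 : ℝ) < t := ht1
    nlinarith
  · exact interior_maximal (fun p (hp : excess H p < 2 * lam) => hp.le)
      (isOpen_lt (continuous_excess hc) continuous_const)

lemma frontier_table (hc : IsCompact H) (hne : H.Nonempty) (hlam : 0 < lam) :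
    frontier (table H lam) = {p | excess H p = 2 * lam} := by
  rw [(isClosed_table hc lam).frontier_eq, interior_table hc hne hlam]
  ext p
  simp only [table, Set.mem_sdiff, mem_ofPred_eq, not_lt]
  exact le_antisymm_iff.symm

lemma notMem_of_excess_eq (hc : IsCompact H) (hlam : 0 < lam) {p : Plane}
    (hp : excess H p = 2 * lam) : p ∉ H := fun h => by
  rw [excess_of_mem hc h] at hp; linarith

lemma subset_interior_table (hc : IsCompact H) (hne : H.Nonempty) (hlam : 0 < lam) :
    H ⊆ interior (table H lam) := by
  rw [interior_table hc hne hlam]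
  intro p hp
  rw [mem_ofPred_eq, excess_of_mem hc hp]; linarith

lemma le_norm_sub (hc : IsCompact H) {p q : Plane} (hp : excess H p = 2 * lam)
    (hq : q ∈ H) : lam ≤ ‖p - q‖ := by
  have := excess_le_add hc p q
  rw [excess_of_mem hc hq, hp] at this
  linarith

lemma excess_lt_of_mem_combo (hc : IsCompact H) (hlam : 0 < lam) {T y z : Plane} (hT : T ∈ H)
    (hy : excess H y ≤ 2 * lam) {k : ℝ} (hk : 0 ≤ k) (hz : T - z = k • (z - y)) :
    excess H z < 2 * lam := by
  have hz' : z = (1 + k)⁻¹ • T + (k * (1 + k)⁻¹) • y := by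
    have h0 : (1 + k) ≠ 0 := by positivity
    have : (1 + k) • z = T + k • y := by
      rw [smul_sub] at hz
      rw [add_smul, one_smul, ← sub_eq_zero]
      have := sub_eq_zero.2 hz
      rw [← neg_eq_zero, ← this]; abel
    rw [mul_comm, mul_smul, ← smul_add, ← this, inv_smul_smul₀ h0]
  have h1 := (convexOn_excess hc).2 (mem_univ T) (mem_univ y)
    (by positivity : 0 ≤ (1 + k)⁻¹) (by positivity : 0 ≤ k * (1 + k)⁻¹) (by field_simp)
  rw [← hz', excess_of_mem hc hT, smul_zero, zero_add, smul_eq_mul] at h1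
  have h2 : k * (1 + k)⁻¹ < 1 := by rw [← div_eq_mul_inv, div_lt_one (by positivity)]; linarith
  have h3 : 0 ≤ k * (1 + k)⁻¹ := by positivity
  nlinarith

theorem strictConvex_table (hconv : Convex ℝ H) (hc : IsCompact H) (hne : H.Nonempty)
    (hlam : 0 < lam) : StrictConvex ℝ (table H lam) := by
  intro x hx y hy hxy a b ha hb hab
  rw [interior_table hc hne hlam]
  change excess H x ≤ 2 * lam at hx
  change excess H y ≤ 2 * lam at hy
  change excess H (a • x + b • y) < 2 * lam
  set z := a • x + b • y with hz
  by_cases hzH : z ∈ H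
  · rw [excess_of_mem hc hzH]; linarith
  obtain ⟨m, β, hw⟩ := exists_isWedge hconv hc hne hzH
  have hpi := Real.pi_pos
  have hright := hw.right
  rw [hz, gap_combo x y hab] at hright
  -- If the chord lies along the supporting line, that line carries a point of `H`, and `z` lies
  -- between it and `x` or `y`. Otherwise the gap at `m + β` is zero at `z` but positive at `x` or
  -- `y`, so the convexity inequality is strict near this angle.
  by_cases hα : ⟪x - y, dir (m + β)⟫ = 0
  · obtain ⟨T, hT⟩ := face_nonempty hc hne (m + β)
    obtain ⟨e1, e2⟩ := hw.sub_eq_left hc hT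
    have e3 := eq_frame (x - y) (m + β)
    rw [hα, zero_smul, zero_add] at e3
    set s := ⟪x - y, ort (m + β)⟫
    set r := ⟪T - z, ort (m + β)⟫
    have hs : s ≠ 0 := by
      rintro hs
      rw [hs, zero_smul, sub_eq_zero] at e3
      exact hxy e3
    have hxz : z - y = a • (x - y) := by
      rw [hz, ← sub_eq_zero, show a • x + b • y - y - a • (x - y) = (a + b - 1) • y by module,
        hab, sub_self, zero_smul]
    have hzx : z - x = (-b) • (x - y) := by
      rw [hz, ← sub_eq_zero, show a • x + b • y - x - (-b) • (x - y) = (a + b - 1) • x by module,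
        hab, sub_self, zero_smul]
    rcases lt_or_gt_of_ne hs with h | h
    · refine excess_lt_of_mem_combo hc hlam hT.1 hx (k := r / (-b * s)) ?_ ?_
      · exact (div_pos e2 (by nlinarith)).le
      · rw [hzx, e3, smul_smul, smul_smul, e1]
        congr 1; field_simp
    · refine excess_lt_of_mem_combo hc hlam hT.1 hy (k := r / (a * s)) ?_ ?_
      · positivity
      · rw [hxz, e3, smul_smul, smul_smul]
        rw [e1]; congr 1; field_simp
  · have hlt : excess H z < a * excess H x + b * excess H y := by
      rw [← sub_pos, excess_combo hc x y a b m, excess_eq_window z m,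
        ← intervalIntegral.integral_sub (((integrable_posGap hc x _ _).const_mul a).add
          ((integrable_posGap hc y _ _).const_mul b)) (integrable_posGap hc z _ _)]
      refine intervalIntegral.integral_pos (by linarith) ?_ ?_ ⟨m + β, ?_, ?_⟩
      · exact ((((continuous_posGap hc x).const_mul a).add
          ((continuous_posGap hc y).const_mul b)).sub (continuous_posGap hc z)).continuousOn
      · intro θ _
        exact sub_nonneg.2 (posGap_combo_le x y ha.le hb.le hab θ)
      · exact ⟨by linarith [hw.pos], by linarith [hw.le]⟩
      · rw [hw.right, max_self, sub_zero]
        have hd : gap H x (m + β) - gap H y (m + β) ≠ 0 := by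
          simp only [gap]
          rwa [sub_sub_sub_cancel_right, ← inner_sub_left]
        rcases lt_trichotomy (gap H x (m + β)) 0 with h | h | h
        · have : 0 < gap H y (m + β) := by
            by_contra h'
            nlinarith [mul_neg_of_pos_of_neg ha h,
              mul_nonpos_of_nonneg_of_nonpos hb.le (not_lt.1 h')]
          exact add_pos_of_nonneg_of_pos (mul_nonneg ha.le (le_max_right _ _))
            (mul_pos hb (lt_max_of_lt_left this))
        · rw [h, mul_zero, zero_add] at hright
          rcases mul_eq_zero.1 hright with h' | h'
          · exact absurd h' hb.ne'
          · rw [h, h', sub_self] at hd; exact absurd rfl hd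
        · exact add_pos_of_pos_of_nonneg (mul_pos ha (lt_max_of_lt_left h))
            (mul_nonneg hb.le (le_max_right _ _))
    nlinarith

/-! ### The gradient is Lipschitz on the boundary of the table -/

/-- Converts a bound on the sine into a bound on the difference, once the vectors are known not to
be nearly opposite. -/
lemma norm_ort_sub_mul_norm_ort_add (a b : ℝ) :
    ‖ort a - ort b‖ * ‖ort a + ort b‖ = 2 * |Real.sin (a - b)| := by
  refine (pow_left_inj₀ (by positivity) (by positivity) two_ne_zero).1 ?_
  rw [mul_pow, mul_pow, sq_abs, @norm_sub_sq_real, @norm_add_sq_real, norm_ort, norm_ort,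
    inner_ort_ort, ← neg_sub a b, Real.cos_neg]
  linear_combination (-4) * Real.sin_sq_add_cos_sq (a - b)

/-- Tangent directions depend on the point in a Lipschitz way. -/
lemma norm_ort_sub_le (hconv : Convex ℝ H) (hlam : 0 < lam) {p p' : Plane} {R σ r r' a a' : ℝ}
    (hp : ∀ q ∈ H, lam ≤ ‖p - q‖) (hσ : |σ| = 1)
    (hr : 0 < r) (hr' : 0 < r') (hR : r ≤ R)
    (hT : p + r • σ • ort a ∈ H) (hT' : p' + r' • σ • ort a' ∈ H)
    (hs : ∀ q ∈ H, ⟪q - p, dir a⟫ ≤ 0) (hs' : ∀ q ∈ H, ⟪q - p', dir a'⟫ ≤ 0)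
    (hl : lam ≤ r) (hl' : lam ≤ r') :
    ‖ort a - ort a'‖ ≤ 4 * R / lam ^ 2 * ‖p - p'‖ := by
  set ε := ‖p - p'‖ with hε
  have hε0 : 0 ≤ ε := norm_nonneg _
  have hR0 : 0 < R := hr.trans_le hR
  have d1 : r' * (σ * Real.sin (a - a')) ≤ ε := by
    have h := hs _ hT'
    have h2 : ⟪p - p', dir a⟫ ≤ ε := by simpa using real_inner_le_norm (p - p') (dir a)
    have e : p' + r' • σ • ort a' - p = r' • σ • ort a' - (p - p') := by abel
    rw [e, inner_sub_left, inner_smul_left, inner_smul_left, inner_ort_dir] at h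
    simp only [conj_trivial] at h
    linarith
  have d2 : r * (-(σ * Real.sin (a - a'))) ≤ ε := by
    have h := hs' _ hT
    have h2 : ⟪p' - p, dir a'⟫ ≤ ε := by
      have := real_inner_le_norm (p' - p) (dir a')
      rwa [norm_dir, mul_one, norm_sub_rev] at this
    have e : p + r • σ • ort a - p' = r • σ • ort a - (p' - p) := by abel
    rw [e, inner_sub_left, inner_smul_left, inner_smul_left, inner_ort_dir, ← neg_sub a a',
      Real.sin_neg] at h
    simp only [conj_trivial] at h
    linarith
  have hsin : lam * |Real.sin (a - a')| ≤ ε := by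
    have e : |Real.sin (a - a')| = |σ * Real.sin (a - a')| := by rw [abs_mul, hσ, one_mul]
    rw [e]
    rcases abs_cases (σ * Real.sin (a - a')) with ⟨h1, h2⟩ | ⟨h1, h2⟩
    · rw [h1]; exact (mul_le_mul_of_nonneg_right hl' h2).trans d1
    · rw [h1]; exact (mul_le_mul_of_nonneg_right hl (by linarith)).trans d2
  have hprod := norm_ort_sub_mul_norm_ort_add a a'
  have hd2 : ‖ort a - ort a'‖ ≤ 2 := by
    refine (norm_sub_le _ _).trans ?_
    rw [norm_ort, norm_ort]; norm_num
  rw [div_mul_eq_mul_div, le_div_iff₀ (by positivity)]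
  -- The sine bound does not exclude nearly opposite directions. For close points, convexity
  -- excludes them; for distant points the trivial bound 2 suffices.
  rcases le_total ε (lam / 2) with h | h
  · have hz : (r' / (r + r')) • (p + r • σ • ort a) + (r / (r + r')) • (p' + r' • σ • ort a') ∈ H :=
      hconv hT hT' (by positivity) (by positivity) (by field_simp; ring)
    have h1 := hp _ hz
    have e : p - ((r' / (r + r')) • (p + r • σ • ort a) + (r / (r + r')) • (p' + r' • σ • ort a'))
        = (r / (r + r')) • (p - p') - (r * r' / (r + r') * σ) • (ort a + ort a') := by
      have h0 : r + r' ≠ 0 := by positivity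
      have : p = (r' / (r + r') + r / (r + r')) • p := by
        rw [← add_div, add_comm, div_self h0, one_smul]
      nth_rewrite 1 [this]
      module
    rw [e] at h1
    have h2 := h1.trans (norm_sub_le _ _)
    rw [norm_smul, norm_smul, Real.norm_eq_abs, Real.norm_eq_abs, abs_mul, hσ, mul_one,
      abs_of_nonneg (by positivity), abs_of_nonneg (by positivity), ← hε] at h2
    have h3 : r / (r + r') * ε ≤ ε :=
      mul_le_of_le_one_left hε0 (by rw [div_le_one (by positivity)]; linarith)
    have h4 : r * r' / (r + r') * ‖ort a + ort a'‖ ≤ R * ‖ort a + ort a'‖ := by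
      refine mul_le_mul_of_nonneg_right ?_ (norm_nonneg _)
      rw [div_le_iff₀ (by positivity)]
      nlinarith
    have h5 : lam / 2 ≤ R * ‖ort a + ort a'‖ := by linarith
    have h6 := mul_le_mul_of_nonneg_left h5 (norm_nonneg (ort a - ort a'))
    have h7 : ‖ort a - ort a'‖ * (R * ‖ort a + ort a'‖) = R * (2 * |Real.sin (a - a')|) := by
      rw [← hprod]; ring
    rw [h7] at h6
    have h8 := mul_le_mul_of_nonneg_left hsin hR0.le
    nlinarith [mul_le_mul_of_nonneg_left h6 hlam.le]
  · have h1 : ‖ort a - ort a'‖ * lam ^ 2 ≤ 2 * lam ^ 2 :=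
      mul_le_mul_of_nonneg_right hd2 (sq_nonneg _)
    have h2 : lam * lam ≤ R * (2 * ε) :=
      mul_le_mul (hl.trans hR) (by linarith) hlam.le hR0.le
    nlinarith

lemma IsWedge.inner_sub_right_nonpos {p : Plane} {m β : ℝ} (hw : IsWedge H p m β)
    (hc : IsCompact H) : ∀ q ∈ H, ⟪q - p, dir (m - β)⟫ ≤ 0 := fun q hq => by
  have h1 := hw.left
  have h2 := inner_le_supp hc hq (m - β)
  rw [gap] at h1
  rw [inner_sub_left]; linarith

lemma IsWedge.inner_sub_left_nonpos {p : Plane} {m β : ℝ} (hw : IsWedge H p m β)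
    (hc : IsCompact H) : ∀ q ∈ H, ⟪q - p, dir (m + β)⟫ ≤ 0 := fun q hq => by
  have h1 := hw.right
  have h2 := inner_le_supp hc hq (m + β)
  rw [gap] at h1
  rw [inner_sub_left]; linarith

/-- The gradient is a difference of two tangent directions, each controlled by `norm_ort_sub_le`;
`R` bounds the tangent lengths by the size of the table. -/
theorem exists_lipschitzOnWith_pull (hconv : Convex ℝ H) (hc : IsCompact H) (hne : H.Nonempty)
    (hlam : 0 < lam) : ∃ C, LipschitzOnWith C (pull H) (frontier (table H lam)) := by
  obtain ⟨R, hR⟩ := exists_norm_sub_le (isCompact_table hc hne lam)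
  have hR0 : 0 ≤ R := by
    obtain ⟨x, hx⟩ := hne
    have hx := interior_subset (subset_interior_table hc ⟨x, hx⟩ hlam hx)
    exact (norm_nonneg _).trans (hR x hx x hx)
  rw [frontier_table hc hne hlam]
  refine ⟨⟨8 * R / lam ^ 2, by positivity⟩, LipschitzOnWith.of_dist_le_mul ?_⟩
  intro p hp p' hp'
  change excess H p = 2 * lam at hp
  change excess H p' = 2 * lam at hp'
  obtain ⟨m, β, hw⟩ := exists_isWedge hconv hc hne (notMem_of_excess_eq hc hlam hp)
  obtain ⟨m', β', hw'⟩ := exists_isWedge hconv hc hne (notMem_of_excess_eq hc hlam hp')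
  have hnr : ∀ p, excess H p = 2 * lam → ∀ T ∈ H, ‖p - T‖ ≤ R := fun p hp T hT =>
    hR p hp.le T (interior_subset (subset_interior_table hc hne hlam hT))
  obtain ⟨S, hS⟩ := face_nonempty hc hne (m - β)
  obtain ⟨S', hS'⟩ := face_nonempty hc hne (m' - β')
  obtain ⟨T, hT⟩ := face_nonempty hc hne (m + β)
  obtain ⟨T', hT'⟩ := face_nonempty hc hne (m' + β')
  have right : ∀ {p m β S}, excess H p = 2 * lam → IsWedge H p m β → S ∈ face H (m - β) →
      ∃ r, 0 < r ∧ r ≤ R ∧ lam ≤ r ∧ p + r • (-1 : ℝ) • ort (m - β) ∈ H := by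
    intro p m β S hp hw hS
    obtain ⟨h1, h2⟩ := hw.sub_eq_right hc hS
    have h3 : ‖p - S‖ = ⟪p - S, ort (m - β)⟫ := by
      nth_rewrite 1 [h1]
      rw [norm_smul, norm_ort, mul_one, Real.norm_of_nonneg h2.le]
    refine ⟨_, h2, h3 ▸ hnr p hp S hS.1, h3 ▸ le_norm_sub hc hp hS.1, ?_⟩
    rw [smul_comm, ← h1]
    simpa using hS.1
  have left : ∀ {p m β S}, excess H p = 2 * lam → IsWedge H p m β → S ∈ face H (m + β) →
      ∃ r, 0 < r ∧ r ≤ R ∧ lam ≤ r ∧ p + r • (1 : ℝ) • ort (m + β) ∈ H := by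
    intro p m β S hp hw hS
    obtain ⟨h1, h2⟩ := hw.sub_eq_left hc hS
    have h3 : ‖p - S‖ = ⟪S - p, ort (m + β)⟫ := by
      rw [norm_sub_rev]
      nth_rewrite 1 [h1]
      rw [norm_smul, norm_ort, mul_one, Real.norm_of_nonneg h2.le]
    refine ⟨_, h2, h3 ▸ hnr p hp S hS.1, h3 ▸ le_norm_sub hc hp hS.1, ?_⟩
    rw [one_smul, ← h1]
    simpa using hS.1
  obtain ⟨r1, a1, a2, a3, a4⟩ := right hp hw hS
  obtain ⟨r2, b1, b2, b3, b4⟩ := right hp' hw' hS'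
  obtain ⟨r3, c1, c2, c3, c4⟩ := left hp hw hT
  obtain ⟨r4, d1, d2, d3, d4⟩ := left hp' hw' hT'
  have k1 := norm_ort_sub_le hconv hlam (fun q hq => le_norm_sub hc hp hq) (by simp) a1 b1 a2 a4 b4
    (hw.inner_sub_right_nonpos hc) (hw'.inner_sub_right_nonpos hc) a3 b3
  have k2 := norm_ort_sub_le hconv hlam (fun q hq => le_norm_sub hc hp hq) (by simp) c1 d1 c2 c4 d4
    (hw.inner_sub_left_nonpos hc) (hw'.inner_sub_left_nonpos hc) c3 d3
  rw [hw.pull_eq hc, hw'.pull_eq hc, dist_eq_norm, dist_eq_norm, sub_sub_sub_comm]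
  refine (norm_sub_le _ _).trans ((add_le_add k1 k2).trans (le_of_eq ?_))
  change _ = 8 * R / lam ^ 2 * _
  ring

/-! ### Polar coordinates -/

lemma inner_pull_pos (hconv : Convex ℝ H) (hc : IsCompact H) (hlam : 0 < lam) {c p : Plane}
    (hcH : c ∈ H) (hp : excess H p = 2 * lam) : 0 < ⟪pull H p, p - c⟫ := by
  have h := inner_pull_le hconv hc ⟨c, hcH⟩ (notMem_of_excess_eq hc hlam hp) c
  rw [excess_of_mem hc hcH, hp, ← neg_sub, inner_neg_right] at h
  linarith

lemma exists_polar (hc : IsCompact H) (hlam : 0 < lam) {c : Plane} (hcH : c ∈ H) :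
    ∃ ρ : ℝ → ℝ, ∀ θ, 0 < ρ θ ∧ excess H (c + ρ θ • dir θ) = 2 * lam := by
  have h : ∀ θ, ∃ r : ℝ, 0 < r ∧ excess H (c + r • dir θ) = 2 * lam := by
    intro θ
    obtain ⟨D, hD⟩ := exists_norm_sub_le hc
    have hD0 : 0 ≤ D := (norm_nonneg _).trans (hD c hcH c hcH)
    have hf : Continuous fun r : ℝ => excess H (c + r • dir θ) :=
      (continuous_excess hc).comp (by fun_prop)
    -- The radius at which `norm_sub_le_excess` forces the excess up to `2 * lam`.
    set M := lam + Real.pi * D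
    have hM : 0 ≤ M := by positivity
    have h0 : excess H (c + (0 : ℝ) • dir θ) = 0 := by
      rw [zero_smul, add_zero, excess_of_mem hc hcH]
    have h1 : 2 * lam ≤ excess H (c + M • dir θ) := by
      have := norm_sub_le_excess hc hD hcH (c + M • dir θ)
      rw [add_sub_cancel_left, norm_smul, norm_dir, mul_one, Real.norm_of_nonneg hM] at this
      simp only [M] at this ⊢
      linarith
    obtain ⟨r, hr, hr'⟩ := intermediate_value_Icc hM hf.continuousOn
      (show 2 * lam ∈ Icc _ _ from ⟨by simp only [h0]; linarith, h1⟩)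
    refine ⟨r, lt_of_le_of_ne hr.1 ?_, hr'⟩
    rintro rfl
    simp only [h0] at hr'
    linarith
  choose ρ hρ using h
  exact ⟨ρ, hρ⟩

lemma excess_lt_of_lt (hc : IsCompact H) {c : Plane} (hcH : c ∈ H) {θ r s : ℝ}
    (hr : 0 < r) (hrs : r < s) (hpos : 0 < excess H (c + r • dir θ)) :
    excess H (c + r • dir θ) < excess H (c + s • dir θ) := by
  have h1 : 1 < s / r := (one_lt_div hr).2 hrs
  have h2 := mul_excess_le hc hcH (r • dir θ) h1.le
  rw [smul_smul, div_mul_cancel₀ _ hr.ne'] at h2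
  nlinarith

variable {ρ : ℝ → ℝ} {c : Plane}

lemma polar_unique (hc : IsCompact H) (hlam : 0 < lam) (hcH : c ∈ H) {θ r s : ℝ} (hr : 0 < r)
    (hs : 0 < s) (h1 : excess H (c + r • dir θ) = 2 * lam)
    (h2 : excess H (c + s • dir θ) = 2 * lam) : r = s := by
  rcases lt_trichotomy r s with h | h | h
  · have := excess_lt_of_lt hc hcH (θ := θ) hr h (by rw [h1]; positivity)
    rw [h1, h2] at this; exact absurd this (lt_irrefl _)
  · exact h
  · have := excess_lt_of_lt hc hcH (θ := θ) hs h (by rw [h2]; positivity)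
    rw [h1, h2] at this; exact absurd this (lt_irrefl _)

lemma continuous_polar (hc : IsCompact H) (hlam : 0 < lam) (hcH : c ∈ H)
    (hρ : ∀ θ, 0 < ρ θ ∧ excess H (c + ρ θ • dir θ) = 2 * lam) : Continuous ρ := by
  have hf : ∀ r : ℝ, Continuous fun θ => excess H (c + r • dir θ) := fun r =>
    (continuous_excess hc).comp (continuous_const.add (continuous_dir.const_smul r))
  refine continuous_iff_continuousAt.2 fun θ₀ => tendsto_order.2 ⟨fun r hr => ?_, fun r hr => ?_⟩
  · rcases le_or_gt r 0 with h | h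
    · exact Eventually.of_forall fun θ => h.trans_lt (hρ θ).1
    have h1 : excess H (c + r • dir θ₀) < 2 * lam := by
      rcases (excess_nonneg (c + r • dir θ₀)).eq_or_lt with h0 | h0
      · rw [← h0]; positivity
      · rw [← (hρ θ₀).2]; exact excess_lt_of_lt hc hcH h hr h0
    filter_upwards [(hf r).continuousAt.eventually (gt_mem_nhds h1)] with θ hθ
    by_contra h2
    rcases (not_lt.1 h2).eq_or_lt with h3 | h3
    · rw [← h3, (hρ θ).2] at hθ; exact lt_irrefl _ hθ
    · have := excess_lt_of_lt hc hcH (θ := θ) (hρ θ).1 h3 (by rw [(hρ θ).2]; positivity)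
      rw [(hρ θ).2] at this
      exact lt_asymm this hθ
  · have h0 := (hρ θ₀).1
    have h1 : 2 * lam < excess H (c + r • dir θ₀) := by
      rw [← (hρ θ₀).2]
      exact excess_lt_of_lt hc hcH h0 hr (by rw [(hρ θ₀).2]; positivity)
    filter_upwards [(hf r).continuousAt.eventually (lt_mem_nhds h1)] with θ hθ
    by_contra h2
    rcases (not_lt.1 h2).eq_or_lt with h3 | h3
    · rw [h3, (hρ θ).2] at hθ; exact lt_irrefl _ hθ
    · have := excess_lt_of_lt hc hcH (θ := θ) (h0.trans hr) h3 (by linarith)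
      rw [(hρ θ).2] at this
      exact lt_asymm this hθ

/-! ### The boundary curve -/

lemma hasDerivAt_dir (θ : ℝ) : HasDerivAt dir (ort θ) θ := by
  have h1 : HasDerivAt (fun θ : ℝ => Real.cos θ • dir 0 + Real.sin θ • ort 0)
      (-Real.sin θ • dir 0 + Real.cos θ • ort 0) θ :=
    ((Real.hasDerivAt_cos θ).smul_const _).add ((Real.hasDerivAt_sin θ).smul_const _)
  have e1 : (fun θ : ℝ => Real.cos θ • dir 0 + Real.sin θ • ort 0) = dir := by
    funext θ; apply plane_ext <;> simp
  have e2 : -Real.sin θ • dir 0 + Real.cos θ • ort 0 = ort θ := by apply plane_ext <;> simp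
  rwa [e1, e2] at h1

/-- Rotation by a right angle. -/
noncomputable def rot : Plane →L[ℝ] Plane :=
  LinearMap.toContinuousLinearMap
    { toFun := fun x => !₂[-x 1, x 0]
      map_add' := fun x y => by apply plane_ext <;> simp [add_comm]
      map_smul' := fun r x => by apply plane_ext <;> simp }

@[simp] lemma rot_zero_coord (x : Plane) : rot x 0 = -x 1 := by simp [rot]
@[simp] lemma rot_one_coord (x : Plane) : rot x 1 = x 0 := by simp [rot]

lemma norm_rot (x : Plane) : ‖rot x‖ = ‖x‖ := by
  refine (pow_left_inj₀ (norm_nonneg _) (norm_nonneg _) two_ne_zero).1 ?_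
  rw [norm_sq_coord, norm_sq_coord]; simp; ring

lemma rot_frame (x : Plane) (θ : ℝ) : rot x = ⟪x, dir θ⟫ • ort θ - ⟪x, ort θ⟫ • dir θ := by
  have := Real.sin_sq_add_cos_sq θ
  apply plane_ext
  · simp [inner_coord]; linear_combination (x 1) * this
  · simp [inner_coord]; linear_combination (-x 0) * this

lemma inner_pull_dir_pos (hconv : Convex ℝ H) (hc : IsCompact H) (hlam : 0 < lam) (hcH : c ∈ H)
    (hρ : ∀ θ, 0 < ρ θ ∧ excess H (c + ρ θ • dir θ) = 2 * lam) (θ : ℝ) :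
    0 < ⟪pull H (c + ρ θ • dir θ), dir θ⟫ := by
  have h := inner_pull_pos hconv hc hlam hcH (hρ θ).2
  rw [add_sub_cancel_left, inner_smul_right] at h
  exact (mul_pos_iff_of_pos_left (hρ θ).1).1 h

-- Implicit differentiation of `excess H (c + ρ θ • dir θ) = 2 * lam`. It uses only
-- differentiability of `excess` at the one point, continuity of `ρ` and a positive radial
-- derivative.
open Asymptotics in
lemma hasDerivAt_polar (hconv : Convex ℝ H) (hc : IsCompact H) (hlam : 0 < lam) (hcH : c ∈ H)
    (hρ : ∀ θ, 0 < ρ θ ∧ excess H (c + ρ θ • dir θ) = 2 * lam) (θ₀ : ℝ) :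
    HasDerivAt ρ (-(ρ θ₀ * ⟪pull H (c + ρ θ₀ • dir θ₀), ort θ₀⟫
      / ⟪pull H (c + ρ θ₀ • dir θ₀), dir θ₀⟫)) θ₀ := by
  have hD := inner_pull_dir_pos hconv hc hlam hcH hρ θ₀
  set k : ℝ → Plane := fun θ => c + ρ θ • dir θ with hk
  change 0 < ⟪pull H (k θ₀), dir θ₀⟫ at hD
  change HasDerivAt ρ (-(ρ θ₀ * ⟪pull H (k θ₀), ort θ₀⟫ / ⟪pull H (k θ₀), dir θ₀⟫)) θ₀
  set G := pull H (k θ₀)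
  set D := ⟪G, dir θ₀⟫
  have hρc := continuous_polar hc hlam hcH hρ
  have hkc : Continuous k := continuous_const.add (hρc.smul continuous_dir)
  set u : ℝ → Plane := fun θ => ρ θ • (dir θ - dir θ₀)
  have hsplit : ∀ θ, k θ - k θ₀ = (ρ θ - ρ θ₀) • dir θ₀ + u θ := fun θ => by
    simp only [k, u]; module
  have hfd := (hasFDerivAt_excess hconv hc ⟨c, hcH⟩
    (notMem_of_excess_eq hc hlam (hρ θ₀).2)).isLittleO
  have h1 : (fun θ => D * (ρ θ - ρ θ₀) + ⟪G, u θ⟫) =o[𝓝 θ₀] fun θ => k θ - k θ₀ := by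
    have h := hfd.comp_tendsto (hkc.tendsto θ₀)
    refine (h.neg_left).congr_left fun θ => ?_
    simp only [Function.comp_apply]
    have e1 : excess H (k θ) = 2 * lam := (hρ θ).2
    have e2 : excess H (c + ρ θ₀ • dir θ₀) = 2 * lam := (hρ θ₀).2
    rw [e1, e2, sub_self, zero_sub, neg_neg, innerSL_apply_apply]
    change ⟪G, k θ - k θ₀⟫ = _
    rw [hsplit, inner_add_right, inner_smul_right, mul_comm]
  have hdir : (fun θ => dir θ - dir θ₀) =O[𝓝 θ₀] fun θ => θ - θ₀ :=
    (hasDerivAt_dir θ₀).isBigO_sub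
  have hu : u =O[𝓝 θ₀] fun θ => θ - θ₀ := by
    have := (hρc.continuousAt (x := θ₀)).isBigO_one ℝ
    simpa using this.smul hdir
  -- The remainder in `h1` is measured by the full increment, which contains `ρ θ - ρ θ₀` itself;
  -- the positive radial derivative `D` absorbs that part.
  have hΔ : (fun θ => ρ θ - ρ θ₀) =O[𝓝 θ₀] u := by
    refine IsBigO.of_bound ((‖G‖ + D / 2) / (D / 2)) ?_
    filter_upwards [h1.bound (half_pos hD)] with θ hθ
    rw [hsplit] at hθ
    have b1 : ‖(ρ θ - ρ θ₀) • dir θ₀ + u θ‖ ≤ ‖ρ θ - ρ θ₀‖ + ‖u θ‖ := by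
      refine (norm_add_le _ _).trans ?_
      rw [norm_smul, norm_dir, mul_one]
    have b2 : ‖⟪G, u θ⟫‖ ≤ ‖G‖ * ‖u θ‖ := norm_inner_le_norm _ _
    have b3 : D * ‖ρ θ - ρ θ₀‖ ≤ ‖D * (ρ θ - ρ θ₀) + ⟪G, u θ⟫‖ + ‖⟪G, u θ⟫‖ := by
      have := norm_sub_le (D * (ρ θ - ρ θ₀) + ⟪G, u θ⟫) ⟪G, u θ⟫
      rwa [add_sub_cancel_right, norm_mul, Real.norm_of_nonneg hD.le] at this
    rw [div_mul_eq_mul_div, le_div_iff₀ (half_pos hD)]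
    have b4 := mul_le_mul_of_nonneg_left b1 (half_pos hD).le
    nlinarith
  have hkO : (fun θ => k θ - k θ₀) =O[𝓝 θ₀] fun θ => θ - θ₀ := by
    have : (fun θ => (ρ θ - ρ θ₀) • dir θ₀) =O[𝓝 θ₀] fun θ => θ - θ₀ := by
      refine IsBigO.trans ?_ (hΔ.trans hu)
      exact IsBigO.of_bound 1 (Eventually.of_forall fun θ => by
        rw [norm_smul, norm_dir, mul_one, one_mul])
    exact (this.add hu).congr_left fun θ => (hsplit θ).symm
  have h2 : (fun θ => ⟪G, u θ⟫ - (θ - θ₀) * (ρ θ₀ * ⟪G, ort θ₀⟫)) =o[𝓝 θ₀] fun θ => θ - θ₀ := by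
    have a1 : (fun θ => (ρ θ - ρ θ₀) * ⟪G, dir θ - dir θ₀⟫) =o[𝓝 θ₀] fun θ => θ - θ₀ := by
      have z : (fun θ => ρ θ - ρ θ₀) =o[𝓝 θ₀] fun _ => (1 : ℝ) := by
        rw [isLittleO_one_iff]
        simpa using (hρc.tendsto θ₀).sub_const (ρ θ₀)
      have z2 : (fun θ => ⟪G, dir θ - dir θ₀⟫) =O[𝓝 θ₀] fun θ => θ - θ₀ :=
        ((innerSL ℝ G).isBigO_comp _ _).trans hdir
      simpa using z.mul_isBigO z2
    have a2 : (fun θ => ρ θ₀ * ⟪G, dir θ - dir θ₀ - (θ - θ₀) • ort θ₀⟫) =o[𝓝 θ₀]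
        fun θ => θ - θ₀ := by
      have z := (hasDerivAt_iff_isLittleO.1 (hasDerivAt_dir θ₀))
      exact (((innerSL ℝ G).isBigO_comp _ _).trans_isLittleO z).const_mul_left _
    refine (a1.add a2).congr_left fun θ => ?_
    simp only [u, inner_sub_right, inner_smul_right]; ring
  rw [hasDerivAt_iff_isLittleO]
  have h3 := ((h1.trans_isBigO hkO).sub h2).const_mul_left D⁻¹
  refine h3.congr_left fun θ => ?_
  rw [smul_eq_mul]
  field_simp
  ring

lemma hasDerivAt_polarCurve (hconv : Convex ℝ H) (hc : IsCompact H) (hlam : 0 < lam) (hcH : c ∈ H)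
    (hρ : ∀ θ, 0 < ρ θ ∧ excess H (c + ρ θ • dir θ) = 2 * lam) (θ : ℝ) :
    HasDerivAt (fun θ => c + ρ θ • dir θ)
      ((ρ θ / ⟪pull H (c + ρ θ • dir θ), dir θ⟫) • rot (pull H (c + ρ θ • dir θ))) θ := by
  have h1 := ((hasDerivAt_polar hconv hc hlam hcH hρ θ).smul (hasDerivAt_dir θ)).const_add c
  refine h1.congr_deriv ?_
  have hD := (inner_pull_dir_pos hconv hc hlam hcH hρ θ).ne'
  rw [rot_frame _ θ, smul_sub, smul_smul, smul_smul, div_mul_cancel₀ _ hD, neg_smul,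
    div_mul_eq_mul_div, sub_eq_add_neg]

/-- Reparameterisation of a periodic `C¹` curve by arc length. -/
lemma exists_arcLength_reparam {s : ℝ → ℝ} (hs : Continuous s) {l T : ℝ} (hl : 0 < l)
    (hls : ∀ θ, l ≤ s θ) (hT : 0 < T) (hper : Function.Periodic s T) :
    ∃ (P : ℝ) (E : ℝ → ℝ), 0 < P ∧ StrictMono E ∧ Function.Surjective E ∧ E 0 = 0 ∧
      (∀ t, E (t + P) = E t + T) ∧ ∀ t, HasDerivAt E (s (E t))⁻¹ t := by
  set S : ℝ → ℝ := fun θ => ∫ x in (0 : ℝ)..θ, s x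
  have hS : ∀ θ, HasDerivAt S (s θ) θ := fun θ =>
    intervalIntegral.integral_hasDerivAt_right (hs.intervalIntegrable _ _)
      (hs.stronglyMeasurableAtFilter _ _) hs.continuousAt
  have hmono : StrictMono S := strictMono_of_deriv_pos fun θ => by
    rw [(hS θ).deriv]; exact hl.trans_le (hls θ)
  have hcont : Continuous S := continuous_iff_continuousAt.2 fun θ => (hS θ).continuousAt
  have hS0 : S 0 = 0 := intervalIntegral.integral_same
  have hlow : Monotone fun θ => S θ - l * θ := by
    refine monotone_of_deriv_nonneg ?_ ?_
    · exact fun θ => ((hS θ).sub ((hasDerivAt_id θ).const_mul l)).differentiableAt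
    · intro θ
      have := ((hS θ).fun_sub ((hasDerivAt_id θ).const_mul l)).deriv
      simp only [id, mul_one] at this
      rw [this]; linarith [hls θ]
  -- The speed is at least `l`, so arc length tends to infinity in both directions.
  have hsurj : Function.Surjective S := by
    refine hcont.surjective ?_ ?_
    · refine tendsto_atTop_mono' atTop ?_ (tendsto_id.const_mul_atTop hl)
      filter_upwards [eventually_ge_atTop 0] with θ hθ
      have := hlow hθ
      simp only [hS0, mul_zero, sub_zero] at this
      simp only [id]; linarith
    · refine tendsto_atBot_mono' atBot ?_ (tendsto_id.const_mul_atBot hl)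
      filter_upwards [eventually_le_atBot 0] with θ hθ
      have := hlow hθ
      simp only [hS0, mul_zero, sub_zero] at this
      simp only [id]; linarith
  set e := hmono.orderIsoOfSurjective S hsurj
  have he : ∀ θ, e θ = S θ := fun θ => rfl
  have hadd : ∀ θ, S (θ + T) = S θ + S T := fun θ => by
    have h1 := hper.intervalIntegral_add_eq 0 θ
    have h2 := intervalIntegral.integral_add_adjacent_intervals
      (hs.intervalIntegrable (μ := volume) 0 θ) (hs.intervalIntegrable θ (θ + T))
    rw [zero_add] at h1
    simp only [S]
    rw [← h2, h1]
  refine ⟨S T, e.symm, ?_, e.symm.strictMono, e.symm.surjective, ?_, fun t => ?_, fun t => ?_⟩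
  · rw [← hS0]; exact hmono hT
  · rw [e.symm_apply_eq, he, hS0]
  · rw [e.symm_apply_eq, he, hadd, ← he (e.symm t), e.apply_symm_apply]
  · exact HasDerivAt.of_local_left_inverse e.symm.continuous.continuousAt (hS (e.symm t))
      (hl.trans_le (hls _)).ne' (Eventually.of_forall fun y => e.apply_symm_apply y)

lemma dir_injOn : InjOn dir (Ico 0 (2 * Real.pi)) := by
  intro a ha b hb h
  have h0 := congrArg (fun x : Plane => x 0) h
  have h1 := congrArg (fun x : Plane => x 1) h
  simp only [dir_zero_coord, dir_one_coord] at h0 h1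
  obtain ⟨n, hn⟩ := Real.Angle.angle_eq_iff_two_pi_dvd_sub.1 (Real.Angle.cos_sin_inj h0 h1)
  have hpi := Real.pi_pos
  have h2 : n < 1 := by
    by_contra hcon
    have : (1 : ℝ) ≤ n := by exact_mod_cast not_lt.1 hcon
    nlinarith [ha.2, hb.1]
  have h3 : -1 < n := by
    by_contra hcon
    have : (n : ℝ) ≤ -1 := by exact_mod_cast not_lt.1 hcon
    nlinarith [ha.1, hb.2]
  obtain rfl : n = 0 := by omega
  simp at hn
  linarith

/-- In arc length the derivative is the normalised, rotated gradient. The gradient is Lipschitz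
along the unit-speed curve and never zero there, so this expression is differentiable almost
everywhere. -/
theorem isDiffCurve_frontier_table (hconv : Convex ℝ H) (hc : IsCompact H) (hne : H.Nonempty)
    (hlam : 0 < lam) : IsDiffAndAETwiceDiffClosedCurve (frontier (table H lam)) := by
  obtain ⟨c, hcH⟩ := hne
  obtain ⟨ρ, hρ⟩ := exists_polar hc hlam hcH
  obtain ⟨C, hC⟩ := exists_lipschitzOnWith_pull hconv hc ⟨c, hcH⟩ hlam
  have hpi := Real.pi_pos
  have hfr := frontier_table hc ⟨c, hcH⟩ hlam
  set k : ℝ → Plane := fun θ => c + ρ θ • dir θ with hk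
  have hkfr : ∀ θ, k θ ∈ frontier (table H lam) := fun θ => by rw [hfr]; exact (hρ θ).2
  have hρc := continuous_polar hc hlam hcH hρ
  have hkc : Continuous k := continuous_const.add (hρc.smul continuous_dir)
  have hGc : Continuous fun θ => pull H (k θ) := hC.continuousOn.comp_continuous hkc hkfr
  have hDpos := inner_pull_dir_pos hconv hc hlam hcH hρ
  have hG0 : ∀ θ, pull H (k θ) ≠ 0 := fun θ h => by
    have := hDpos θ
    change 0 < ⟪pull H (k θ), dir θ⟫ at this
    rw [h, inner_zero_left] at this
    exact lt_irrefl _ this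
  set s : ℝ → ℝ := fun θ => ρ θ / ⟪pull H (k θ), dir θ⟫ * ‖pull H (k θ)‖ with hs
  have hsc : Continuous s :=
    (hρc.div (hGc.inner continuous_dir) fun θ => (hDpos θ).ne').mul hGc.norm
  have hρper : ∀ θ, ρ (θ + 2 * Real.pi) = ρ θ := fun θ => by
    refine polar_unique hc hlam hcH (hρ _).1 (hρ θ).1 ?_ (hρ θ).2
    have := (hρ (θ + 2 * Real.pi)).2
    rwa [dir_add_two_pi] at this
  have hkper : ∀ θ, k (θ + 2 * Real.pi) = k θ := fun θ => by
    simp only [k, hρper, dir_add_two_pi]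
  have hsper : Function.Periodic s (2 * Real.pi) := fun θ => by
    simp only [s, hρper, dir_add_two_pi, hkper]
  have hρl : ∀ θ, lam ≤ ρ θ := fun θ => by
    have := le_norm_sub hc (hρ θ).2 hcH
    rwa [add_sub_cancel_left, norm_smul, norm_dir, mul_one, Real.norm_of_nonneg (hρ θ).1.le] at this
  have hsl : ∀ θ, lam ≤ s θ := fun θ => by
    have h1 : ⟪pull H (k θ), dir θ⟫ ≤ ‖pull H (k θ)‖ := by
      simpa using real_inner_le_norm (pull H (k θ)) (dir θ)
    have h2 := hDpos θ
    change 0 < ⟪pull H (k θ), dir θ⟫ at h2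
    refine (hρl θ).trans ?_
    simp only [s]
    rw [div_mul_eq_mul_div, le_div_iff₀ h2]
    exact mul_le_mul_of_nonneg_left h1 (hρ θ).1.le
  obtain ⟨P, E, hP, hEm, hEs, hE0, hEP, hEd⟩ :=
    exists_arcLength_reparam hsc hlam hsl (by linarith : 0 < 2 * Real.pi) hsper
  have hγ : ∀ t, HasDerivAt (fun t => k (E t))
      (‖pull H (k (E t))‖⁻¹ • rot (pull H (k (E t)))) t := fun t => by
    have h1 := (hasDerivAt_polarCurve hconv hc hlam hcH hρ (E t)).scomp t (hEd t)
    refine h1.congr_deriv ?_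
    change (s (E t))⁻¹ • (ρ (E t) / ⟪pull H (k (E t)), dir (E t)⟫) • rot (pull H (k (E t))) = _
    rw [smul_smul]
    congr 1
    have h2 : ρ (E t) / ⟪pull H (k (E t)), dir (E t)⟫ ≠ 0 :=
      (div_pos (hρ _).1 (hDpos _)).ne'
    simp only [s]
    rw [mul_inv, mul_right_comm, inv_mul_cancel₀ h2, one_mul]
  have hn : ∀ t, ‖deriv (fun t => k (E t)) t‖ = 1 := fun t => by
    rw [(hγ t).deriv, norm_smul, norm_inv, norm_norm, norm_rot,
      inv_mul_cancel₀ (norm_ne_zero_iff.2 (hG0 _))]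
  refine ⟨P, fun t => k (E t), hP, fun t => ?_, ?_, ?_, fun t => (hγ t).differentiableAt, hn, ?_⟩
  · simp only [hEP, hkper]
  · intro t ht t' ht' h
    have hIco : ∀ t ∈ Ico 0 P, E t ∈ Ico 0 (2 * Real.pi) := fun t ht => by
      have h1 := hEP 0
      rw [hE0, zero_add, zero_add] at h1
      exact ⟨hE0 ▸ hEm.monotone ht.1, h1 ▸ hEm ht.2⟩
    have h1 : ρ (E t) • dir (E t) = ρ (E t') • dir (E t') := add_left_cancel h
    have h2 : ρ (E t) = ρ (E t') := by
      have := congrArg norm h1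
      rwa [norm_smul, norm_smul, norm_dir, norm_dir, mul_one, mul_one,
        Real.norm_of_nonneg (hρ _).1.le, Real.norm_of_nonneg (hρ _).1.le] at this
    rw [h2] at h1
    have h3 := smul_right_injective Plane (hρ (E t')).1.ne' h1
    exact hEm.injective (dir_injOn (hIco t ht) (hIco t' ht') h3)
  · ext p
    constructor
    · rintro ⟨t, rfl⟩; exact hkfr _
    · intro hp
      rw [hfr] at hp
      have hpc : 0 < ‖p - c‖ := hlam.trans_le (le_norm_sub hc hp hcH)
      obtain ⟨θ, -, hθ⟩ := exists_dir_eq (w := ‖p - c‖⁻¹ • (p - c))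
        (by rw [norm_smul, norm_inv, norm_norm, inv_mul_cancel₀ hpc.ne']) 0
      have e : c + ‖p - c‖ • dir θ = p := by
        rw [← hθ, smul_inv_smul₀ hpc.ne', add_sub_cancel]
      obtain ⟨t, rfl⟩ := hEs θ
      refine ⟨t, ?_⟩
      have : ρ (E t) = ‖p - c‖ :=
        polar_unique hc hlam hcH (hρ _).1 hpc (hρ _).2 (by rw [e]; exact hp)
      simp only [k, this, e]
  · have hγL : LipschitzWith 1 fun t => k (E t) :=
      lipschitzWith_of_nnnorm_deriv_le (fun t => (hγ t).differentiableAt) fun t => by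
        rw [← NNReal.coe_le_coe, coe_nnnorm, hn]; simp
    have hGL : LipschitzWith (C * 1) fun t => pull H (k (E t)) := by
      rw [← lipschitzOnWith_univ]
      exact hC.comp hγL.lipschitzOnWith fun t _ => hkfr _
    have hd : deriv (fun t => k (E t))
        = fun t => ‖pull H (k (E t))‖⁻¹ • rot (pull H (k (E t))) :=
      funext fun t => (hγ t).deriv
    filter_upwards [hGL.ae_differentiableAt_real] with t ht
    rw [hd]
    exact ((ht.norm ℝ (hG0 _)).inv (norm_ne_zero_iff.2 (hG0 _))).smul
      (rot.differentiableAt.comp t ht)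

/-! ### The billiard -/

/-- Along `ν - ν'` the first normal puts nearby points into `K` and the second puts them outside. -/
lemma IsInwardUnitNormal.eq {K : Set Plane} {q ν ν' : Plane} (h : IsInwardUnitNormal K q ν)
    (h' : IsInwardUnitNormal K q ν') : ν = ν' := by
  by_contra hne
  set d := ν - ν'
  have hd : 0 < ‖d‖ := norm_pos_iff.2 (sub_ne_zero.2 hne)
  have h0 : ‖d‖ ^ 2 = 2 - 2 * ⟪ν, ν'⟫ := by
    rw [@norm_sub_sq_real, h.1, h'.1]; ring
  have e1 : ⟪d, ν⟫ = ‖d‖ ^ 2 / 2 := by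
    rw [inner_sub_left, real_inner_self_eq_norm_sq, h.1, h0, real_inner_comm]; ring
  have e2 : ⟪d, ν'⟫ = -(‖d‖ ^ 2 / 2) := by
    rw [inner_sub_left, real_inner_self_eq_norm_sq, h'.1, h0]; ring
  have k1 := h.2 (‖d‖ / 4) (by positivity)
  have k2 := h'.2 (‖d‖ / 4) (by positivity)
  have ht : Tendsto (fun t : ℝ => q + t • d) (𝓝[>] 0) (𝓝 q) := by
    have : Continuous fun t : ℝ => q + t • d := by fun_prop
    have h2 := this.tendsto 0
    simp only [zero_smul, add_zero] at h2
    exact h2.mono_left nhdsWithin_le_nhds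
  obtain ⟨t, ⟨⟨c1, -⟩, ⟨-, c2⟩⟩, ht0⟩ :=
    ((ht.eventually (k1.and k2)).and self_mem_nhdsWithin).exists
  have ht0 : 0 < t := ht0
  have hp : 0 < t * ‖d‖ ^ 2 := by positivity
  rw [add_sub_cancel_left, norm_smul, Real.norm_of_nonneg ht0.le, inner_smul_left, conj_trivial]
    at c1 c2
  rw [e1] at c1
  rw [e2] at c2
  exact c2 (by nlinarith) (c1 (by nlinarith))

/-- First-order expansion of the excess, whose gradient is `2 sin β • dir m`; dividing by `2 sin β >
0` normalises it. -/
lemma IsWedge.isInwardUnitNormal {p : Plane} {m β : ℝ} (hw : IsWedge H p m β)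
    (hc : IsCompact H) (hp : excess H p = 2 * lam) :
    IsInwardUnitNormal (table H lam) p (-dir m) := by
  refine ⟨by rw [norm_neg, norm_dir], fun ε hε => ?_⟩
  have hs := hw.sin_pos
  have h := (hw.hasFDerivAt_excess hc).isLittleO
  filter_upwards [h.bound (mul_pos (mul_pos two_pos hs) hε)] with x hx
  rw [innerSL_apply_apply, ort_sub_ort, inner_smul_left, conj_trivial, hp, Real.norm_eq_abs,
    abs_le] at hx
  rw [inner_neg_right, real_inner_comm]
  constructor
  · intro h1
    have := mul_lt_mul_of_pos_left h1 (mul_pos two_pos hs)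
    change excess H x ≤ 2 * lam
    linarith [hx.2]
  · intro h1 h2
    have := mul_lt_mul_of_pos_left h1 (mul_pos two_pos hs)
    change excess H x ≤ 2 * lam at h2
    linarith [hx.1]

/-! ### Reflection and the lines that meet `H` -/

lemma gap_congr {θ ψ : ℝ} (h : dir θ = dir ψ) (p : Plane) : gap H p θ = gap H p ψ := by
  simp only [gap, supp, h]

lemma IsWedge.gap_pos_iff_abs {p : Plane} {m β θ : ℝ} (hw : IsWedge H p m β)
    (hθ : |θ - m| ≤ Real.pi) : 0 < gap H p θ ↔ |θ - m| < β := by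
  refine ⟨fun h => ?_, hw.gap_pos θ⟩
  by_contra h'
  rcases (not_lt.1 h').eq_or_lt with h1 | h1
  · rcases abs_choice (θ - m) with h2 | h2
    · have : θ = m + β := by linarith
      rw [this, hw.right] at h; exact lt_irrefl _ h
    · have : θ = m - β := by linarith
      rw [this, hw.left] at h; exact lt_irrefl _ h
  · exact lt_asymm h (hw.gap_neg θ h1 hθ)

lemma IsWedge.gap_pos_reflect {p : Plane} {m β : ℝ} (hw : IsWedge H p m β) (θ : ℝ) :
    0 < gap H p (2 * m - θ) ↔ 0 < gap H p θ := by
  obtain ⟨ψ, hψ, e⟩ := exists_dir_eq (norm_dir θ) m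
  have e0 := congrArg (fun x : Plane => x 0) e
  have e1 := congrArg (fun x : Plane => x 1) e
  simp only [dir_zero_coord, dir_one_coord] at e0 e1
  have e' : dir (2 * m - θ) = dir (2 * m - ψ) := by
    apply plane_ext
    · simp only [dir_zero_coord, Real.cos_sub, e0, e1]
    · simp only [dir_one_coord, Real.sin_sub, e0, e1]
  have h1 : |2 * m - ψ - m| = |ψ - m| := by
    rw [← abs_neg]; congr 1; ring
  rw [gap_congr e, gap_congr e', hw.gap_pos_iff_abs hψ, hw.gap_pos_iff_abs (h1 ▸ hψ), h1]

/-- The line through the position in the direction of the velocity meets `H`. -/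
def LineMeets (H : Set Plane) (x : Plane × Plane) : Prop := ∃ r : ℝ, x.1 + r • x.2 ∈ H

/-- A line misses `H` exactly when `H` lies strictly on one side of it, which is a positive gap at
one of its two normals. -/
lemma lineMeets_iff (hconv : Convex ℝ H) (hc : IsCompact H) (hne : H.Nonempty) (p : Plane)
    (φ : ℝ) : LineMeets H (p, -ort φ) ↔ ¬ 0 < gap H p φ ∧ ¬ 0 < gap H p (φ + Real.pi) := by
  rw [gap_pos_iff hc hne, gap_pos_iff hc hne]
  simp only [dir_add_pi, inner_neg_right, neg_lt_neg_iff]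
  constructor
  · rintro ⟨r, hr⟩
    have h : ⟪p + r • -ort φ, dir φ⟫ = ⟪p, dir φ⟫ := by
      rw [inner_add_left, inner_smul_left, inner_neg_left, inner_ort_dir]; simp
    exact ⟨fun h1 => (h1 _ hr).ne h, fun h1 => (h1 _ hr).ne' h⟩
  · rintro ⟨h1, h2⟩
    push Not at h1 h2
    obtain ⟨x, hx, hx'⟩ := h1
    obtain ⟨y, hy, hy'⟩ := h2
    have hcn := (hconv.isPreconnected.image (fun x => ⟪x, dir φ⟫)
      (by fun_prop : Continuous fun x : Plane => ⟪x, dir φ⟫).continuousOn).ordConnected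
    obtain ⟨z, hz, hzr⟩ := hcn.out (mem_image_of_mem _ hy) (mem_image_of_mem _ hx)
      (⟨hy', hx'⟩ : ⟪p, dir φ⟫ ∈ Icc _ _)
    refine ⟨-⟪z - p, ort φ⟫, ?_⟩
    have h := eq_frame (z - p) φ
    have h0 : ⟪z - p, dir φ⟫ = 0 := by rw [inner_sub_left]; exact sub_eq_zero.2 hzr
    rw [h0, zero_smul, zero_add] at h
    simp only [smul_neg, neg_smul, neg_neg]
    rw [← h, add_sub_cancel]
    exact hz

/-- The supporting lines through a point make equal angles with the normal of the table, so the
reflection preserves the lines that meet `H`. -/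
lemma IsWedge.lineMeets_reflect {p : Plane} {m β : ℝ} (hw : IsWedge H p m β)
    (hconv : Convex ℝ H) (hc : IsCompact H) (hne : H.Nonempty) {v : Plane} (hv : ‖v‖ = 1) :
    LineMeets H (p, v - (2 * ⟪v, -dir m⟫) • -dir m) ↔ LineMeets H (p, v) := by
  obtain ⟨φ, -, hφ⟩ := exists_dir_eq (w := rot v) (by rw [norm_rot, hv]) 0
  have e0 := congrArg (fun x : Plane => x 0) hφ
  have e1 := congrArg (fun x : Plane => x 1) hφ
  simp only [dir_zero_coord, dir_one_coord, rot_zero_coord, rot_one_coord] at e0 e1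
  have hv' : v = -ort φ := by
    apply plane_ext
    · simp [e1]
    · simp [← e0]
  -- In terms of the normal angle of the line, the reflection is `φ ↦ 2 * m - φ`, which preserves
  -- the wedge.
  have hr : v - (2 * ⟪v, -dir m⟫) • -dir m = -ort (2 * m - φ) := by
    have hm := Real.sin_sq_add_cos_sq m
    rw [hv']
    apply plane_ext
    · simp [inner_coord, Real.sin_sub, Real.sin_two_mul, Real.cos_two_mul]
      ring
    · simp [inner_coord, Real.cos_sub, Real.sin_two_mul, Real.cos_two_mul]
      linear_combination (2 * Real.cos φ) * hm
  rw [hr, hv', lineMeets_iff hconv hc hne, lineMeets_iff hconv hc hne, hw.gap_pos_reflect]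
  have : gap H p (2 * m - φ + Real.pi) = gap H p (2 * m - (φ + Real.pi)) := by
    rw [← gap_add_two_pi p (2 * m - (φ + Real.pi))]; congr 1; ring
  rw [this, hw.gap_pos_reflect]

lemma lineMeets_shift {q v : Plane} (t : ℝ) :
    LineMeets H (q + t • v, v) ↔ LineMeets H (q, v) := by
  constructor
  · rintro ⟨r, hr⟩
    refine ⟨t + r, ?_⟩
    simpa only [add_smul, add_assoc] using hr
  · rintro ⟨r, hr⟩
    refine ⟨r - t, ?_⟩
    simpa only [sub_smul, add_add_sub_cancel] using hr

lemma norm_reflect {v ν : Plane} (hν : ‖ν‖ = 1) : ‖v - (2 * ⟪v, ν⟫) • ν‖ = ‖v‖ := by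
  refine (pow_left_inj₀ (norm_nonneg _) (norm_nonneg _) two_ne_zero).1 ?_
  rw [@norm_sub_sq_real, norm_smul, hν, inner_smul_right, Real.norm_eq_abs, mul_one, sq_abs]
  ring

lemma norm_velocity_eq {K : Set Plane} {x y : Plane × Plane} {t : ℝ}
    (h : BilliardFlow K x t y) : ‖y.2‖ = ‖x.2‖ := by
  induction h with
  | free => rfl
  | reflect q v ν t ht hint hbd hν => exact norm_reflect hν.1
  | trans x y z s t _ _ h1 h2 => exact h2.trans h1

/-- Free motion stays on one line, and a reflection replaces the line by its mirror image.
Membership in the phase space is carried along because the unit speed is needed at each reflection.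
-/
theorem flow_lineMeets_iff (hconv : Convex ℝ H) (hc : IsCompact H) (hne : H.Nonempty)
    (hlam : 0 < lam) {x y : Plane × Plane} {t : ℝ} (h : BilliardFlow (table H lam) x t y)
    (hx : x ∈ phaseSpace (table H lam)) :
    y ∈ phaseSpace (table H lam) ∧ (LineMeets H x ↔ LineMeets H y) := by
  induction h with
  | free q v t ht hint =>
    refine ⟨?_, (lineMeets_shift t).symm⟩
    rcases ht.eq_or_lt with rfl | ht
    · simpa using hx
    · exact ⟨hx.1, Or.inl (hint t ⟨ht, le_rfl⟩)⟩
  | reflect q v ν t ht hint hbd hν =>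
    have hp := hbd
    rw [frontier_table hc hne hlam] at hp
    change excess H (q + t • v) = 2 * lam at hp
    have hpH := notMem_of_excess_eq hc hlam hp
    obtain ⟨m, β, hw⟩ := exists_isWedge hconv hc hne hpH
    obtain rfl := IsInwardUnitNormal.eq hν (hw.isInwardUnitNormal hc hp)
    have hv : ‖v‖ = 1 := hx.1
    refine ⟨⟨(norm_reflect hν.1).trans hv, Or.inr ⟨hbd, -dir m, hν, ?_⟩⟩, ?_⟩
    · have h1 := hint (t / 2) ⟨by linarith, by linarith⟩
      rw [interior_table hc hne hlam] at h1
      change excess H (q + (t / 2) • v) < 2 * lam at h1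
      have h2 := inner_pull_le hconv hc hne hpH (q + (t / 2) • v)
      rw [hw.pull_eq_smul hc, hp, show q + (t / 2) • v - (q + t • v) = (-(t / 2)) • v by module,
        inner_smul_left, inner_smul_right, conj_trivial, real_inner_comm] at h2
      have hs := hw.sin_pos
      have h3 : 0 < ⟪v, dir m⟫ := by
        by_contra hcon
        have : 0 ≤ 2 * Real.sin β * (-(t / 2) * ⟪v, dir m⟫) :=
          mul_nonneg (by linarith) (mul_nonneg_of_nonpos_of_nonpos (by linarith) (not_lt.1 hcon))
        linarith
      simp only [inner_sub_left, inner_smul_left, conj_trivial, inner_neg_left, inner_neg_right,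
        real_inner_self_eq_norm_sq, norm_dir]
      linarith
    · rw [hw.lineMeets_reflect hconv hc hne hv, lineMeets_shift]
  | trans x y z s t _ _ h1 h2 =>
    obtain ⟨a1, a2⟩ := h1 hx
    obtain ⟨b1, b2⟩ := h2 a1
    exact ⟨b1, a2.trans b2⟩

/-- By the gradient inequality `H` lies strictly on the inner side of the tangent at `q`, so an
inward velocity reaches it in positive time. By convexity the excess stays below `2 * lam` on the
way. -/
lemma meets_after_reflection (hconv : Convex ℝ H) (hc : IsCompact H) (hne : H.Nonempty)
    (hlam : 0 < lam) {q v : Plane} (hx : (q, v) ∈ phaseSpace (table H lam))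
    (hm : LineMeets H (q, v)) (hq : q ∈ frontier (table H lam)) :
    ∃ s > (0 : ℝ), (∀ r ∈ Ioc 0 s, q + r • v ∈ interior (table H lam)) ∧ q + s • v ∈ H := by
  have hp := hq
  rw [frontier_table hc hne hlam] at hp
  change excess H q = 2 * lam at hp
  have hpH := notMem_of_excess_eq hc hlam hp
  obtain ⟨m, β, hw⟩ := exists_isWedge hconv hc hne hpH
  obtain ⟨ν, hν, hpos⟩ : ∃ ν, IsInwardUnitNormal (table H lam) q ν ∧ 0 < ⟪v, ν⟫ := by
    rcases hx.2 with h | h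
    · exact absurd h hq.2
    · exact h.2
  obtain rfl := IsInwardUnitNormal.eq hν (hw.isInwardUnitNormal hc hp)
  obtain ⟨s, hs⟩ := hm
  change q + s • v ∈ H at hs
  have hsin := hw.sin_pos
  have hs0 : 0 < s := by
    have h2 := inner_pull_le hconv hc hne hpH (q + s • v)
    rw [hw.pull_eq_smul hc, hp, excess_of_mem hc hs, add_sub_cancel_left, inner_smul_left,
      inner_smul_right, conj_trivial, real_inner_comm] at h2
    rw [inner_neg_right] at hpos
    by_contra hcon
    have : 0 ≤ 2 * Real.sin β * (s * ⟪v, dir m⟫) :=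
      mul_nonneg (by linarith) (mul_nonneg_of_nonpos_of_nonpos (not_lt.1 hcon) (by linarith))
    linarith
  refine ⟨s, hs0, fun r hr => ?_, hs⟩
  rw [interior_table hc hne hlam]
  change excess H (q + r • v) < 2 * lam
  have hrs : r / s ≤ 1 := (div_le_one hs0).2 hr.2
  have hrs0 : 0 < r / s := div_pos hr.1 hs0
  have h1 := (convexOn_excess hc).2 (mem_univ q) (mem_univ (q + s • v)) (sub_nonneg.2 hrs) hrs0.le
    (sub_add_cancel 1 (r / s))
  rw [excess_of_mem hc hs, hp, smul_zero, add_zero, smul_eq_mul, smul_add, smul_smul,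
    div_mul_cancel₀ _ hs0.ne', ← add_assoc, ← add_smul, sub_add_cancel, one_smul] at h1
  nlinarith

end StringBilliard

/-! ### The theorem -/

theorem theorem1 (H : Set Plane) (hconv : Convex ℝ H) (hcomp : IsCompact H) (hne : H.Nonempty)
    (lam : ℝ) (hlam : 0 < lam) :
    ∃ K : Set Plane,
      IsCompact K ∧ H ⊆ interior K ∧
      frontier K = {p | p ∉ H ∧ stringPotential H p = convexPerimeter H + 2 * lam} ∧
      (∀ p ∈ frontier K, ∀ q ∈ H, lam ≤ ‖p - q‖) ∧
      (StrictConvex ℝ K ∧ IsDiffAndAETwiceDiffClosedCurve (frontier K)) ∧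
      ∃ Ω₁ Ω₂ : Set (Plane × Plane),
        phaseSpace K = Ω₁ ∪ Ω₂ ∧ Disjoint Ω₁ Ω₂ ∧
        IsFlowInvariant K Ω₁ ∧ IsFlowInvariant K Ω₂ ∧
        (∀ x ∈ Ω₁, MeetsAfterEveryReflection K H x) ∧
        (∀ x ∈ Ω₂, NeverMeets K H x) := by
  open StringBilliard in
  have hsub := subset_interior_table hcomp hne hlam
  have hfr := frontier_table hcomp hne hlam
  refine ⟨table H lam, isCompact_table hcomp hne lam, hsub, ?_, ?_,
    ⟨strictConvex_table hconv hcomp hne hlam, isDiffCurve_frontier_table hconv hcomp hne hlam⟩,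
    -- The whole line counts, not just the forward ray: a state that has already passed `H` belongs
    -- to the same trajectory as one about to reach it.
    {x | x ∈ phaseSpace (table H lam) ∧ LineMeets H x},
    {x | x ∈ phaseSpace (table H lam) ∧ ¬ LineMeets H x}, ?_, ?_, ?_, ?_, ?_, ?_⟩
  · rw [hfr]
    ext p
    constructor
    · intro hp
      have hpH := notMem_of_excess_eq hcomp hlam hp
      refine ⟨hpH, ?_⟩
      rw [stringPotential_eq hconv hcomp hne hpH]
      exact congrArg _ hp
    · rintro ⟨hpH, hp⟩
      rw [stringPotential_eq hconv hcomp hne hpH] at hp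
      exact add_left_cancel hp
  · intro p hp q hq
    rw [hfr] at hp
    exact le_norm_sub hcomp hp hq
  · ext x
    constructor
    · intro hx
      by_cases h : LineMeets H x
      · exact Or.inl ⟨hx, h⟩
      · exact Or.inr ⟨hx, h⟩
    · rintro (h | h) <;> exact h.1
  · exact Set.disjoint_left.2 fun x h1 h2 => h2.2 h1.2
  · intro x hx y hy t hxy
    have h := (flow_lineMeets_iff hconv hcomp hne hlam hxy hx).2
    exact ⟨fun h1 => ⟨hy, h.1 h1.2⟩, fun h1 => ⟨hx, h.2 h1.2⟩⟩
  · intro x hx y hy t hxy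
    have h := (flow_lineMeets_iff hconv hcomp hne hlam hxy hx).2
    exact ⟨fun h1 => ⟨hy, fun h2 => h1.2 (h.2 h2)⟩, fun h1 => ⟨hx, fun h2 => h1.2 (h.1 h2)⟩⟩
  · rintro x ⟨hx, hm⟩ t y hxy hy
    obtain ⟨hy', h⟩ := flow_lineMeets_iff hconv hcomp hne hlam hxy hx
    exact meets_after_reflection hconv hcomp hne hlam hy' (h.1 hm) hy
  · rintro x ⟨hx, hm⟩ t y (hxy | hyx) hyH
    · have h := (flow_lineMeets_iff hconv hcomp hne hlam hxy hx).2
      exact hm (h.2 ⟨0, by simpa using hyH⟩)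
    · have hy : y ∈ phaseSpace (table H lam) :=
        ⟨(norm_velocity_eq hyx).symm.trans hx.1, Or.inl (hsub hyH)⟩
      have h := (flow_lineMeets_iff hconv hcomp hne hlam hyx hy).2
      exact hm (h.1 ⟨0, by simpa using hyH⟩)
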